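/- **Online bipartite matching with distance weight.** Offline points $x_1,\dots,x_n\in\mathbb{R}^d$ ($n,d\ge 1$) are given in advance. Online points $y_1,y_2,\dots\in\mathbb{R}^d$ (at most $n$ of them) arrive one at a time, and each must be matched on arrival to some offline point $x_i$; several online points may be matched to the same $x_i$. The value of a matching $\sigma$ of $y_1,\dots,y_t$ is $$\sum_{i=1}^n \max_{j\le t:\ \sigma(j)=i}\|x_i-y_j\|_2$$ (an empty maximum is $0$), and $\mathsf{opt}_t$ is the largest value of a matching of $y_1,\dots,y_t$ to the offline points. The model of computation is a real RAM with fair coin flips: unit-cost exact $+,-,\cdot,/,\sqrt{\cdot}$ and comparisons on reals; unit-cost addition, truncated subtraction and comparison on integers that are at most the memory size; indirect addressing; no rounding. Space is the number of memory cells. $\tilde O(f)$ means at most $C\,f\,\log^k(2+f)$ with absolute constants $C,k$. **Theorem.** There is a randomized data structure (one program for all $n,d\geq 1$ and all $\epsilon,\delta\in(0,1)$) that uses $\tilde O(\epsilon^{-2}nd\log(2n/\delta))$ space and supports the following operations. * $\textsc{Init}(x_1,\dots,x_n,\epsilon,\delta)$, in time $\tilde O(\epsilon^{-2}nd\log(2n/\delta))$.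 * $\textsc{Update}(y)$: takes an online point $y\in\mathbb{R}^d$ and matches it to an offline point, in time $\tilde O(\epsilon^{-2}(n+d)\log(2n/\delta))$. * $\textsc{Query}()$: outputs the value of the current matching between the offline points and the online points known so far, in time $O(1)$. The space and time bounds hold for every outcome of the coin flips. For all offline points and every sequence of updates and queries with at most $n$ updates, with probability at least $1-\delta$ over the coin flips, the matching has competitive ratio $\frac12(1-2\epsilon)$ throughout: after every number $t$ of updates its value is at least $\frac12(1-2\epsilon)\,\mathsf{opt}_t$. -/

import Mathlib

open scoped NNReal

/-! ### A randomized real RAM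

Programs are finite and do not depend on the input sizes.  A machine has finitely many integer and
real registers (those that its program mentions), an integer memory and a real memory of `S` cells
each, a read-only input buffer of reals, and a source of fair coin flips.  Real arithmetic is exact;
there is no rounding and no integer multiplication.  Integers are words: they may not exceed `S`. -/

namespace RealRAM

/-- An outcome of the coin flips of the machine. -/
abbrev Coins : Type := ℕ → Bool

/-- The law of an infinite sequence of independent fair coin flips. -/
noncomputable def coinMeasure : MeasureTheory.Measure Coins :=
  MeasureTheory.Measure.infinitePi fun _ : ℕ => (PMF.uniformOfFintype Bool).toMeasure

/-- A configuration of the machine; `flips` is the number of coins flipped so far. -/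
structure State where
  ireg : ℕ → ℕ
  rreg : ℕ → ℝ
  imem : ℕ → ℕ
  rmem : ℕ → ℝ
  input : ℕ → ℝ
  flips : ℕ

/-- Primitive instructions. Operands are register numbers, except for the constant in `iconst`. The
first operand is the target, except in `istore` and `rstore`, whose first operand is the register
that holds the address. -/
inductive Instr where
  | iconst (r c : ℕ)
  | imove (r a : ℕ)
  | iadd (r a b : ℕ)
  | isub (r a b : ℕ)
  | iload (r a : ℕ)
  | istore (a r : ℕ)
  | coin (r : ℕ)
  | rcast (r a : ℕ)
  | rmove (r a : ℕ)
  | radd (r a b : ℕ)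
  | rsub (r a b : ℕ)
  | rmul (r a b : ℕ)
  | rdiv (r a b : ℕ)
  | rsqrt (r a : ℕ)
  | rload (r a : ℕ)
  | rstore (a r : ℕ)
  | rinput (r a : ℕ)

/-- Store an integer in a register. -/
def State.setI (s : State) (r v : ℕ) : State := { s with ireg := Function.update s.ireg r v }

/-- Store a real number in a register. -/
def State.setR (s : State) (r : ℕ) (v : ℝ) : State :=
  { s with rreg := Function.update s.rreg r v }

open Classical in
/-- The effect of a primitive instruction on a machine with memories of `S` cells. The value `none`
means that the instruction is illegal: an address outside the memory, an integer overflow, a division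
by zero, or the square root of a negative number. -/
noncomputable def Instr.exec (S : ℕ) (ω : Coins) : Instr → State → Option State
  | .iconst r c, s => if c ≤ S then some (s.setI r c) else none
  | .imove r a, s => some (s.setI r (s.ireg a))
  | .iadd r a b, s =>
      if s.ireg a + s.ireg b ≤ S then some (s.setI r (s.ireg a + s.ireg b)) else none
  | .isub r a b, s => some (s.setI r (s.ireg a - s.ireg b))
  | .iload r a, s => if s.ireg a < S then some (s.setI r (s.imem (s.ireg a))) else none
  | .istore a r, s =>
      if s.ireg a < S then
        some { s with imem := Function.update s.imem (s.ireg a) (s.ireg r) } else none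
  | .coin r, s =>
      some { s.setI r (if ω s.flips then 1 else 0) with flips := s.flips + 1 }
  | .rcast r a, s => some (s.setR r (s.ireg a : ℝ))
  | .rmove r a, s => some (s.setR r (s.rreg a))
  | .radd r a b, s => some (s.setR r (s.rreg a + s.rreg b))
  | .rsub r a b, s => some (s.setR r (s.rreg a - s.rreg b))
  | .rmul r a b, s => some (s.setR r (s.rreg a * s.rreg b))
  | .rdiv r a b, s => if s.rreg b ≠ 0 then some (s.setR r (s.rreg a / s.rreg b)) else none
  | .rsqrt r a, s => if 0 ≤ s.rreg a then some (s.setR r (Real.sqrt (s.rreg a))) else none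
  | .rload r a, s => if s.ireg a < S then some (s.setR r (s.rmem (s.ireg a))) else none
  | .rstore a r, s =>
      if s.ireg a < S then
        some { s with rmem := Function.update s.rmem (s.ireg a) (s.rreg r) } else none
  | .rinput r a, s => some (s.setR r (s.input (s.ireg a)))

/-- Tests: comparison of two integer registers or of two real registers. -/
inductive Test where
  | ilt (a b : ℕ)
  | rlt (a b : ℕ)

/-- The truth of a test in a configuration. -/
def Test.Holds : Test → State → Prop
  | .ilt a b, s => s.ireg a < s.ireg b
  | .rlt a b, s => s.rreg a < s.rreg b

/-- Structured programs over the primitive instructions. -/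
inductive Prog where
  | skip
  | prim (i : Instr)
  | seq (p q : Prog)
  | ite (b : Test) (p q : Prog)
  | loop (b : Test) (p : Prog)

/-- `Exec S ω p s t s'`: with memories of `S` cells and coins `ω`, the program `p` started in `s`
performs only legal instructions and halts in `s'` after exactly `t` steps. Every primitive
instruction and every evaluation of a test is one step. -/
inductive Exec (S : ℕ) (ω : Coins) : Prog → State → ℕ → State → Prop
  | skip (s : State) : Exec S ω .skip s 1 s
  | prim {i : Instr} {s s' : State} (h : i.exec S ω s = some s') : Exec S ω (.prim i) s 1 s'
  | seq {p q : Prog} {s s' s'' : State} {t t' : ℕ} (h : Exec S ω p s t s')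
      (h' : Exec S ω q s' t' s'') : Exec S ω (.seq p q) s (t + t') s''
  | ite_true {b : Test} {p q : Prog} {s s' : State} {t : ℕ} (hb : b.Holds s)
      (h : Exec S ω p s t s') : Exec S ω (.ite b p q) s (t + 1) s'
  | ite_false {b : Test} {p q : Prog} {s s' : State} {t : ℕ} (hb : ¬ b.Holds s)
      (h : Exec S ω q s t s') : Exec S ω (.ite b p q) s (t + 1) s'
  | loop_stop {b : Test} {p : Prog} {s : State} (hb : ¬ b.Holds s) : Exec S ω (.loop b p) s 1 s
  | loop_step {b : Test} {p : Prog} {s s' s'' : State} {t t' : ℕ} (hb : b.Holds s)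
      (h : Exec S ω p s t s') (h' : Exec S ω (.loop b p) s' t' s'') :
      Exec S ω (.loop b p) s (t + t' + 1) s''

end RealRAM

/-! ### Online bipartite matching with distance weight -/

namespace OnlineMatching

open RealRAM

/-- The value of the matching in which the online point `y j` is matched to the offline point
`x (σ j)`: every offline point contributes the largest weight of an edge at it (and `0` if there is
none), where the weight of an edge is the Euclidean distance of its endpoints. -/
noncomputable def matchingValue {n m d : ℕ} (x : Fin n → EuclideanSpace ℝ (Fin d))
    (y : Fin m → EuclideanSpace ℝ (Fin d)) (σ : Fin m → Fin n) : ℝ :=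
  ∑ i : Fin n, (((Finset.univ.filter fun j => σ j = i).sup fun j => nndist (x i) (y j) : ℝ≥0) : ℝ)

/-- The maximal value of a matching of the online points `y` to the offline points `x`. -/
noncomputable def optValue {n m d : ℕ} (x : Fin n → EuclideanSpace ℝ (Fin d))
    (y : Fin m → EuclideanSpace ℝ (Fin d)) : ℝ :=
  ⨆ σ : Fin m → Fin n, matchingValue x y σ

/-- What a user may ask for once the data structure is initialized. -/
inductive Request (d : ℕ) where
  | update (y : EuclideanSpace ℝ (Fin d))
  | query

/-- The number of online points in a sequence of requests. -/
def numUpdates {d : ℕ} : List (Request d) → ℕ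
  | [] => 0
  | .update _ :: rs => numUpdates rs + 1
  | .query :: rs => numUpdates rs

/-- A request together with the reply: for an online point the index of the offline point to which it
is matched, for a query the number returned. -/
inductive Event (n d : ℕ) where
  | matched (y : EuclideanSpace ℝ (Fin d)) (i : Fin n)
  | answered (v : ℝ)

/-- The request that an event replies to. -/
def Event.request {n d : ℕ} : Event n d → Request d
  | .matched y _ => .update y
  | .answered _ => .query

/-- The edges of the matching built by a sequence of events. -/
def edges {n d : ℕ} : List (Event n d) → List (EuclideanSpace ℝ (Fin d) × Fin n)
  | [] => []
  | .matched y i :: es => (y, i) :: edges es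
  | .answered _ :: es => edges es

/-- The value of the matching built by a sequence of events. -/
noncomputable def algValue {n d : ℕ} (x : Fin n → EuclideanSpace ℝ (Fin d))
    (es : List (Event n d)) : ℝ :=
  matchingValue x (fun j => ((edges es).get j).1) (fun j => ((edges es).get j).2)

/-- The optimal value of a matching of the online points that occur in a sequence of events. -/
noncomputable def optOf {n d : ℕ} (x : Fin n → EuclideanSpace ℝ (Fin d))
    (es : List (Event n d)) : ℝ :=
  optValue x (fun j => ((edges es).get j).1)

/-- Every query returns the value of the matching between the offline points and the online points
known at that time. -/
def AnswersMatchingValue {n d : ℕ} (x : Fin n → EuclideanSpace ℝ (Fin d))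
    (es : List (Event n d)) : Prop :=
  ∀ (pre : List (Event n d)) (v : ℝ), (pre ++ [Event.answered v]) <+: es → v = algValue x pre

/-- At every time the matching is worth at least `Γ` times the optimum for the online points known at
that time. -/
def Competitive {n d : ℕ} (Γ : ℝ) (x : Fin n → EuclideanSpace ℝ (Fin d))
    (es : List (Event n d)) : Prop :=
  ∀ pre : List (Event n d), pre <+: es → Γ * optOf x pre ≤ algValue x pre

/-- A data structure is given by the programs of its three procedures. -/
structure DataStructure where
  init : Prog
  update : Prog
  query : Prog

/-- The input buffer of `init`: `ε`, `δ`, and then the coordinates of `x 0`, of `x 1`, and so on. -/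
noncomputable def initInput {n d : ℕ} (ε δ : ℝ) (x : Fin n → EuclideanSpace ℝ (Fin d)) : ℕ → ℝ
  | 0 => ε
  | 1 => δ
  | k + 2 =>
      if h : k < n * d then
        x (finProdFinEquiv.symm ⟨k, h⟩).1 (finProdFinEquiv.symm ⟨k, h⟩).2
      else 0

/-- The input buffer of `update`: the coordinates of the online point. -/
noncomputable def pointInput {d : ℕ} (y : EuclideanSpace ℝ (Fin d)) : ℕ → ℝ :=
  fun k => if h : k < d then y ⟨k, h⟩ else 0

/-- The configuration in which `init` starts: `n` and `d` are in the integer registers `0` and `1`,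
everything else but the input buffer is zero, and no coin has been flipped. -/
noncomputable def initState {n d : ℕ} (ε δ : ℝ) (x : Fin n → EuclideanSpace ℝ (Fin d)) : State where
  ireg := fun k => if k = 0 then n else if k = 1 then d else 0
  rreg := fun _ => 0
  imem := fun _ => 0
  rmem := fun _ => 0
  input := initInput ε δ x
  flips := 0

/-- `Session A S TU TQ ω s es`: from configuration `s` the data structure serves the requests of `es`
one after the other with the replies recorded in `es`, every update within `TU` steps and every query
within `TQ` steps. An update leaves its reply in integer register `0`, a query in real register `0`.
Between two calls only the input buffer is changed. -/
inductive Session {n d : ℕ} (A : DataStructure) (S : ℕ) (TU TQ : ℝ) (ω : Coins) :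
    State → List (Event n d) → Prop
  | nil (s : State) : Session A S TU TQ ω s []
  | update {s s' : State} {t : ℕ} {y : EuclideanSpace ℝ (Fin d)} {i : Fin n} {es : List (Event n d)}
      (h : Exec S ω A.update { s with input := pointInput y } t s') (ht : (t : ℝ) ≤ TU)
      (hi : s'.ireg 0 = (i : ℕ)) (hs : Session A S TU TQ ω s' es) :
      Session A S TU TQ ω s (.matched y i :: es)
  | query {s s' : State} {t : ℕ} {v : ℝ} {es : List (Event n d)}
      (h : Exec S ω A.query { s with input := fun _ => 0 } t s') (ht : (t : ℝ) ≤ TQ)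
      (hv : s'.rreg 0 = v) (hs : Session A S TU TQ ω s' es) :
      Session A S TU TQ ω s (.answered v :: es)

/-- A complete run: `init` within `TI` steps, followed by a session. -/
def IsRun {n d : ℕ} (A : DataStructure) (S : ℕ) (TI TU TQ : ℝ) (ω : Coins) (ε δ : ℝ)
    (x : Fin n → EuclideanSpace ℝ (Fin d)) (es : List (Event n d)) : Prop :=
  ∃ (t : ℕ) (s : State), Exec S ω A.init (initState ε δ x) t s ∧ (t : ℝ) ≤ TI ∧
    Session A S TU TQ ω s es

/-- The bound `C * f * polylog f` behind the notation `Õ(f)`. -/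
noncomputable def softO (C : ℝ) (k : ℕ) (f : ℝ) : ℝ := C * f * Real.log (2 + f) ^ k

end OnlineMatching

/-! The data structure is a greedy algorithm on randomly projected points. Initialization draws a matrix
of random signs with `m = O(ε⁻² log (2 n / δ))` rows and stores, for each offline point, the point and
its image. An online point `y` is projected, and goes to an offline point at which the weight of the
heaviest edge grows most, where edges are weighted by the distances of the *images*. The exact distance
is computed only for the chosen edge. It enters the reported value of the matching but has no influence
on the later choices.

Being greedy for one fixed family of weights, the matching is worth at least half of the optimum for
these weights (`IsGreedy.sum_load_le`); the choices would lose this guarantee if they compared projected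
distances with exact ones. If the projected distances are within factors `(1 ± ε) √m` of the true ones,
then passing from one family of weights to the other costs a factor `(1 - ε) / (1 + ε) ≥ 1 - 2 ε`
(`IsGreedy.competitive`).

That all `n ^ 2` distances are preserved with probability `1 - δ` is the Johnson–Lindenstrauss argument:
the square of a Rademacher sum has an almost Gaussian moment generating function near zero
(`sum_exp_mul_sq_le`), Markov's inequality bounds both tails (`card_signNormSq_tail_le`), and a union
bound is taken over the pairs (`ofReal_le_coinMeasure_preserves`). Only `m * d` coins matter, so these
are statements about finite counts of sign matrices, transferred by `coinMeasure_signMatrix_mem_le`.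

The programs are verified with total-correctness rules that carry a bound on the number of steps (`Wp`).
Since integers cannot be multiplied, all addresses are computed by walking pointers, and the number of
rows is found by doubling and counting. The specifications `wp_init` and `wp_update` hold for all coins,
and `exists_session` chains them. No logarithmic factors beyond those of the bound are needed, so
`softO` is used with exponent `0`. -/

/-! ### Total correctness with a time bound -/

namespace RealRAM

/-- The precondition under which a primitive instruction is legal. -/
def Instr.Legal (S : ℕ) : Instr → State → Prop
  | .iconst _ c, _ => c ≤ S
  | .iadd _ a b, s => s.ireg a + s.ireg b ≤ S
  | .iload _ a, s => s.ireg a < S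
  | .istore a _, s => s.ireg a < S
  | .rdiv _ _ b, s => s.rreg b ≠ 0
  | .rsqrt _ a, s => 0 ≤ s.rreg a
  | .rload _ a, s => s.ireg a < S
  | .rstore a _, s => s.ireg a < S
  | _, _ => True

/-- The effect of a primitive instruction, ignoring whether it is legal. -/
noncomputable def Instr.effect (ω : Coins) : Instr → State → State
  | .iconst r c, s => s.setI r c
  | .imove r a, s => s.setI r (s.ireg a)
  | .iadd r a b, s => s.setI r (s.ireg a + s.ireg b)
  | .isub r a b, s => s.setI r (s.ireg a - s.ireg b)
  | .iload r a, s => s.setI r (s.imem (s.ireg a))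
  | .istore a r, s => { s with imem := Function.update s.imem (s.ireg a) (s.ireg r) }
  | .coin r, s => { s.setI r (if ω s.flips then 1 else 0) with flips := s.flips + 1 }
  | .rcast r a, s => s.setR r (s.ireg a : ℝ)
  | .rmove r a, s => s.setR r (s.rreg a)
  | .radd r a b, s => s.setR r (s.rreg a + s.rreg b)
  | .rsub r a b, s => s.setR r (s.rreg a - s.rreg b)
  | .rmul r a b, s => s.setR r (s.rreg a * s.rreg b)
  | .rdiv r a b, s => s.setR r (s.rreg a / s.rreg b)
  | .rsqrt r a, s => s.setR r (Real.sqrt (s.rreg a))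
  | .rload r a, s => s.setR r (s.rmem (s.ireg a))
  | .rstore a r, s => { s with rmem := Function.update s.rmem (s.ireg a) (s.rreg r) }
  | .rinput r a, s => s.setR r (s.input (s.ireg a))

theorem Instr.exec_eq_some {S : ℕ} {ω : Coins} {i : Instr} {s s' : State} :
    i.exec S ω s = some s' ↔ i.Legal S s ∧ i.effect ω s = s' := by
  cases i <;> simp [Instr.exec, Instr.Legal, Instr.effect]

/-- The registers with numbers below `a` (integers) and `b` (reals) are not targets of `i`. -/
def Instr.keeps (a b : ℕ) : Instr → Bool
  | .iconst r _ | .imove r _ | .iadd r _ _ | .isub r _ _ | .iload r _ | .coin r => a ≤ r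
  | .rcast r _ | .rmove r _ | .radd r _ _ | .rsub r _ _ | .rmul r _ _ | .rdiv r _ _ | .rsqrt r _
  | .rload r _ | .rinput r _ => b ≤ r
  | .istore _ _ | .rstore _ _ => true

/-- The registers with numbers below `a` (integers) and `b` (reals) are not targets in `p`. -/
def Prog.keeps (a b : ℕ) : Prog → Bool
  | .skip => true
  | .prim i => i.keeps a b
  | .seq p q => p.keeps a b && q.keeps a b
  | .ite _ p q => p.keeps a b && q.keeps a b
  | .loop _ p => p.keeps a b

/-- Two configurations agree on the input buffer and on the registers with numbers below `a`
(integers) and `b` (reals). -/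
structure Frame (a b : ℕ) (s s' : State) : Prop where
  ireg : ∀ k < a, s'.ireg k = s.ireg k
  rreg : ∀ k < b, s'.rreg k = s.rreg k
  input : s'.input = s.input

theorem Frame.refl (a b : ℕ) (s : State) : Frame a b s s :=
  ⟨fun _ _ => rfl, fun _ _ => rfl, rfl⟩

theorem Frame.trans {a b : ℕ} {s s' s'' : State} (h : Frame a b s s') (h' : Frame a b s' s'') :
    Frame a b s s'' :=
  ⟨fun k hk => (h'.ireg k hk).trans (h.ireg k hk), fun k hk => (h'.rreg k hk).trans (h.rreg k hk),
    h'.input.trans h.input⟩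

theorem Frame.mono {a b a' b' : ℕ} {s s' : State} (h : Frame a b s s') (ha : a' ≤ a)
    (hb : b' ≤ b) : Frame a' b' s s' :=
  ⟨fun k hk => h.ireg k (hk.trans_le ha), fun k hk => h.rreg k (hk.trans_le hb), h.input⟩

theorem Instr.frame_effect {a b : ℕ} {ω : Coins} {i : Instr} (s : State)
    (hi : i.keeps a b = true) : Frame a b s (i.effect ω s) := by
  cases i <;> simp only [Instr.keeps, decide_eq_true_eq] at hi <;>
    refine ⟨fun k hk => ?_, fun k hk => ?_, rfl⟩ <;>
    first
    | rfl
    | exact Function.update_of_ne (by omega) _ _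

theorem Exec.frame {S : ℕ} {ω : Coins} {p : Prog} {s s' : State} {t a b : ℕ}
    (h : Exec S ω p s t s') (hp : p.keeps a b = true) : Frame a b s s' := by
  induction h with
  | skip s => exact .refl a b s
  | prim h =>
    rw [Instr.exec_eq_some] at h
    rw [← h.2]
    exact Instr.frame_effect _ hp
  | seq _ _ ih ih' =>
    simp only [Prog.keeps, Bool.and_eq_true] at hp
    exact (ih hp.1).trans (ih' hp.2)
  | ite_true _ _ ih =>
    simp only [Prog.keeps, Bool.and_eq_true] at hp
    exact ih hp.1
  | ite_false _ _ ih =>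
    simp only [Prog.keeps, Bool.and_eq_true] at hp
    exact ih hp.2
  | loop_stop _ => exact .refl a b _
  | loop_step _ _ _ ih ih' => exact (ih hp).trans (ih' hp)

/-- From `s`, the program `p` halts within `T` steps in a configuration that satisfies `Q`. -/
def Wp (S : ℕ) (ω : Coins) (p : Prog) (T : ℕ) (Q : State → Prop) (s : State) : Prop :=
  ∃ t s', Exec S ω p s t s' ∧ t ≤ T ∧ Q s'

variable {S : ℕ} {ω : Coins} {p q : Prog} {T T' : ℕ} {Q Q' : State → Prop} {s : State}

theorem Wp.mono (h : Wp S ω p T Q s) (hT : T ≤ T') (hQ : ∀ s', Q s' → Q' s') :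
    Wp S ω p T' Q' s := by
  obtain ⟨t, s', he, ht, hs⟩ := h
  exact ⟨t, s', he, ht.trans hT, hQ s' hs⟩

theorem Wp.with_frame (a b : ℕ) (h : Wp S ω p T Q s) (hp : p.keeps a b = true) :
    Wp S ω p T (fun s' => Frame a b s s' ∧ Q s') s := by
  obtain ⟨t, s', he, ht, hs⟩ := h
  exact ⟨t, s', he, ht, he.frame hp, hs⟩

theorem Wp.skip (h : Q s) : Wp S ω .skip 1 Q s := ⟨1, s, .skip s, le_rfl, h⟩

theorem Wp.seq (h : Wp S ω p T Q' s) (h' : ∀ s', Q' s' → Wp S ω q T' Q s') :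
    Wp S ω (.seq p q) (T + T') Q s := by
  obtain ⟨t, s', he, ht, hs⟩ := h
  obtain ⟨t', s'', he', ht', hs'⟩ := h' s' hs
  exact ⟨t + t', s'', .seq he he', add_le_add ht ht', hs'⟩

theorem Wp.ite {b : Test} (h : b.Holds s → Wp S ω p T Q s) (h' : ¬ b.Holds s → Wp S ω q T Q s) :
    Wp S ω (.ite b p q) (T + 1) Q s := by
  by_cases hb : b.Holds s
  · obtain ⟨t, s', he, ht, hs⟩ := h hb
    exact ⟨t + 1, s', .ite_true hb he, by omega, hs⟩
  · obtain ⟨t, s', he, ht, hs⟩ := h' hb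
    exact ⟨t + 1, s', .ite_false hb he, by omega, hs⟩

/-- A loop that is known to make `N` rounds, with invariant `I`. The registers below `a` and `c`,
which the body does not touch, are taken care of by the rule. -/
theorem Wp.loop {b : Test} (a c N T : ℕ) (I : ℕ → State → Prop) (hp : p.keeps a c = true)
    (h0 : I 0 s)
    (hstep : ∀ k < N, ∀ s', Frame a c s s' → I k s' → b.Holds s' ∧ Wp S ω p T (I (k + 1)) s')
    (hend : ∀ s', Frame a c s s' → I N s' → ¬ b.Holds s') (hT : N * (T + 1) + 1 ≤ T')
    (hQ : ∀ s', Frame a c s s' → I N s' → Q s') :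
    Wp S ω (.loop b p) T' Q s := by
  have key : ∀ j ≤ N, ∀ s', Frame a c s s' → I (N - j) s' →
      Wp S ω (.loop b p) (j * (T + 1) + 1) Q s' := by
    intro j
    induction j with
    | zero =>
      intro _ s' hf hI
      have hb := Exec.loop_stop (S := S) (ω := ω) (p := p) (hend s' hf hI)
      exact ⟨1, s', hb, by omega, hQ s' hf hI⟩
    | succ j ih =>
      intro hj s' hf hI
      obtain ⟨hb, t, s₁, he, ht, hs⟩ := hstep (N - (j + 1)) (by omega) s' hf hI
      rw [show N - (j + 1) + 1 = N - j by omega] at hs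
      obtain ⟨t', s₂, he', ht', hs'⟩ := ih (by omega) s₁ (hf.trans (he.frame hp)) hs
      exact ⟨t + t' + 1, s₂, .loop_step hb he he', by rw [Nat.succ_mul]; omega, hs'⟩
  exact (key N le_rfl s (.refl a c s) (by simpa using h0)).mono hT fun _ h => h

/-- Straight-line code: the instructions `l`, one after the other. -/
def block : List Instr → Prog
  | [] => .skip
  | i :: l => .seq (.prim i) (block l)

/-- After the straight-line code `l`, all of whose instructions are legal, `Q` holds. -/
def Straight (S : ℕ) (ω : Coins) : List Instr → (State → Prop) → State → Prop
  | [], Q, s => Q s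
  | i :: l, Q, s => i.Legal S s ∧ Straight S ω l Q (i.effect ω s)

theorem Wp.block {l : List Instr} (h : Straight S ω l Q s) :
    Wp S ω (block l) (l.length + 1) Q s := by
  induction l generalizing s with
  | nil => exact .skip h
  | cons i l ih =>
    obtain ⟨t, s', he, ht, hs⟩ := ih h.2
    exact ⟨1 + t, s', .seq (.prim (Instr.exec_eq_some.2 ⟨h.1, rfl⟩)) he, by
      simp only [List.length_cons]; omega, hs⟩

/-- Straight-line code followed by another program; `Q'` is what is needed after the code. -/
theorem Wp.block_seq {l : List Instr} (a c T : ℕ) (Q' : State → Prop)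
    (hl : (RealRAM.block l).keeps a c = true) (h : Straight S ω l Q' s)
    (h' : ∀ s', Frame a c s s' → Q' s' → Wp S ω p T Q s') (hT : l.length + 1 + T ≤ T') :
    Wp S ω (.seq (RealRAM.block l) p) T' Q s :=
  (Wp.seq ((Wp.block h).with_frame a c hl) fun s' hs' => h' s' hs'.1 hs'.2).mono hT fun _ h => h

end RealRAM

/-! ### Subroutines: copying a vector, matrix times vector, Euclidean distance -/

namespace RealRAM

/-- The memory `mem` after the values `f 0, …, f (len - 1)` have been written from address `o` on. -/
noncomputable def writeBlock (mem : ℕ → ℝ) (o len : ℕ) (f : ℕ → ℝ) : ℕ → ℝ :=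
  fun a => if o ≤ a ∧ a < o + len then f (a - o) else mem a

theorem writeBlock_zero (mem : ℕ → ℝ) (o : ℕ) (f : ℕ → ℝ) : writeBlock mem o 0 f = mem := by
  funext a
  exact if_neg (by omega)

theorem update_writeBlock (mem : ℕ → ℝ) (o k : ℕ) (f : ℕ → ℝ) :
    Function.update (writeBlock mem o k f) (o + k) (f k) = writeBlock mem o (k + 1) f := by
  funext a
  by_cases ha : a = o + k
  · subst ha
    simp [writeBlock]
  · rw [Function.update_of_ne ha]
    unfold writeBlock
    congr 1
    apply propext
    omega

theorem writeBlock_apply {mem : ℕ → ℝ} {o len : ℕ} {f : ℕ → ℝ} {k : ℕ} (hk : k < len) :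
    writeBlock mem o len f (o + k) = f k := by
  unfold writeBlock
  rw [if_pos (by omega)]
  congr 1
  omega

theorem writeBlock_of_notMem {mem : ℕ → ℝ} {o len : ℕ} {f : ℕ → ℝ} {a : ℕ}
    (ha : a < o ∨ o + len ≤ a) : writeBlock mem o len f a = mem a :=
  if_neg (by omega)

/-- Copies `d` cells of the input buffer, from the position in register `20` on, to the memory, from
the address in register `21` on. Both registers are advanced by `d`. -/
def copyProg : Prog :=
  .seq (block [.iadd 22 21 1])
    (.loop (.ilt 21 22)
      (block [.rinput 20 20, .rstore 21 20, .iadd 20 20 6, .iadd 21 21 6]))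

variable {S : ℕ} {ω : Coins} {s : State}

theorem wp_copy {a o d : ℕ} (h1 : s.ireg 1 = d) (h6 : s.ireg 6 = 1) (h20 : s.ireg 20 = a)
    (h21 : s.ireg 21 = o) (ha : a + d ≤ S) (ho : o + d ≤ S) :
    Wp S ω copyProg (d * 6 + 3)
      (fun s' => Frame 20 20 s s' ∧ s'.ireg 20 = a + d ∧ s'.ireg 21 = o + d ∧
        s'.rmem = writeBlock s.rmem o d fun k => s.input (a + k)) s := by
  refine Wp.with_frame 20 20 ?_ rfl
  refine Wp.block_seq 20 20 (d * 6 + 1) (fun s' => s'.ireg 20 = a ∧ s'.ireg 21 = o ∧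
    s'.ireg 22 = o + d ∧ s'.rmem = s.rmem) rfl ?_ ?_ (by simp; omega)
  · simp [Straight, Instr.Legal, Instr.effect, State.setI, *]
  rintro s1 hf1 ⟨e20, e21, e22, em⟩
  refine Wp.loop 20 20 d 5 (fun k s' => s'.ireg 20 = a + k ∧ s'.ireg 21 = o + k ∧
    s'.ireg 22 = o + d ∧ s'.rmem = writeBlock s.rmem o k fun k => s.input (a + k)) rfl
    ?_ ?_ ?_ (by omega) ?_
  · simp [e20, e21, e22, em, writeBlock_zero]
  · rintro k hk s' hf ⟨f20, f21, f22, fm⟩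
    have f6 : s'.ireg 6 = 1 := by rw [hf.ireg 6 (by norm_num), hf1.ireg 6 (by norm_num), h6]
    have fi : s'.input = s.input := by rw [hf.input, hf1.input]
    refine ⟨by simp only [Test.Holds]; omega, Wp.block ?_⟩
    simp [Straight, Instr.Legal, Instr.effect, State.setI, State.setR, f6, f20, f21, f22, fm, fi,
      ← update_writeBlock, ← add_assoc]
    omega
  · rintro s' - ⟨-, f21, f22, -⟩
    simp [Test.Holds, f21, f22]
  · rintro s' - ⟨f20, f21, -, fm⟩
    exact ⟨f20, f21, fm⟩

/-- Multiplies the `m × d` matrix stored row by row from address `0` on with the vector at the address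
in register `19`, and writes the product to the memory from the address in register `21` on. -/
def matVecProg : Prog :=
  .seq (block [.iconst 33 0, .iadd 24 21 3])
    (.loop (.ilt 21 24)
      (.seq (block [.imove 30 19, .iadd 31 19 1, .rsub 30 30 30])
        (.seq
          (.loop (.ilt 30 31)
            (block [.rload 31 33, .rload 32 30, .rmul 31 31 32, .radd 30 30 31, .iadd 33 33 6,
              .iadd 30 30 6]))
          (block [.rstore 21 30, .iadd 21 21 6]))))

theorem row_index_lt {r m c d : ℕ} (hr : r < m) (hc : c < d) : r * d + c < m * d :=
  calc r * d + c < (r + 1) * d := by rw [Nat.succ_mul]; omega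
    _ ≤ m * d := Nat.mul_le_mul_right d hr

theorem wp_matVec {v o d m : ℕ} (h1 : s.ireg 1 = d) (h3 : s.ireg 3 = m) (h6 : s.ireg 6 = 1)
    (h19 : s.ireg 19 = v) (h21 : s.ireg 21 = o) (hv : v + d ≤ o) (hm : m * d ≤ o)
    (ho : o + m ≤ S) :
    Wp S ω matVecProg (m * (8 * d + 9) + 4)
      (fun s' => Frame 21 20 s s' ∧ s'.ireg 21 = o + m ∧
        s'.rmem = writeBlock s.rmem o m
          fun r => ∑ c ∈ Finset.range d, s.rmem (r * d + c) * s.rmem (v + c)) s := by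
  set g : ℕ → ℝ := fun r => ∑ c ∈ Finset.range d, s.rmem (r * d + c) * s.rmem (v + c) with hg
  refine Wp.with_frame 21 20 ?_ rfl
  refine Wp.block_seq 20 20 (m * (8 * d + 9) + 1) (fun s' => s'.ireg 21 = o ∧ s'.ireg 24 = o + m ∧
    s'.ireg 33 = 0 ∧ s'.rmem = s.rmem) rfl ?_ ?_ (by simp; omega)
  · simp [Straight, Instr.Legal, Instr.effect, State.setI, *]
  rintro s1 hf1 ⟨e21, e24, e33, em⟩
  refine Wp.loop 20 20 m (8 * d + 8) (fun r s' => s'.ireg 21 = o + r ∧ s'.ireg 24 = o + m ∧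
    s'.ireg 33 = r * d ∧ s'.rmem = writeBlock s.rmem o r g) rfl ?_ ?_ ?_ le_rfl ?_
  · simp [e21, e24, e33, em, writeBlock_zero]
  · rintro r hr s' hf ⟨f21, f24, f33, fm⟩
    have hff := hf1.trans hf
    have f1 : s'.ireg 1 = d := by rw [hff.ireg 1 (by norm_num), h1]
    have f6 : s'.ireg 6 = 1 := by rw [hff.ireg 6 (by norm_num), h6]
    have f19 : s'.ireg 19 = v := by rw [hff.ireg 19 (by norm_num), h19]
    refine ⟨by simp only [Test.Holds]; omega, ?_⟩
    refine Wp.block_seq 30 30 (8 * d + 4) (fun s' => s'.ireg 30 = v ∧ s'.ireg 31 = v + d ∧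
      s'.ireg 33 = r * d ∧ s'.rreg 30 = 0 ∧ s'.rmem = writeBlock s.rmem o r g) rfl ?_ ?_
      (by simp; omega)
    · simp [Straight, Instr.Legal, Instr.effect, State.setI, State.setR, *]
      omega
    rintro s2 hf2 ⟨g30, g31, g33, gr, gm⟩
    refine Wp.mono (Wp.seq (T := 8 * d + 1) (T' := 3) (Q' := fun s' => Frame 30 30 s2 s' ∧
      s'.ireg 33 = r * d + d ∧ s'.rreg 30 = g r ∧ s'.rmem = writeBlock s.rmem o r g) ?_ ?_)
      (by omega) (fun _ h => h)
    · refine Wp.loop 30 30 d 7 (fun c s' => s'.ireg 30 = v + c ∧ s'.ireg 31 = v + d ∧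
        s'.ireg 33 = r * d + c ∧
        s'.rreg 30 = ∑ c ∈ Finset.range c, s.rmem (r * d + c) * s.rmem (v + c) ∧
        s'.rmem = writeBlock s.rmem o r g) rfl ?_ ?_ ?_ (by omega) ?_
      · simp [g30, g31, g33, gr, gm]
      · -- The part of the product written so far overlaps neither the matrix nor the vector.
        rintro c hc s3 hf3 ⟨k30, k31, k33, kr, km⟩
        have k6 : s3.ireg 6 = 1 := by
          rw [hf3.ireg 6 (by norm_num), hf2.ireg 6 (by norm_num), f6]
        have hlt := row_index_lt hr hc
        have hA : writeBlock s.rmem o r g (r * d + c) = s.rmem (r * d + c) :=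
          writeBlock_of_notMem (by omega)
        have hV : writeBlock s.rmem o r g (v + c) = s.rmem (v + c) :=
          writeBlock_of_notMem (by omega)
        refine ⟨by simp only [Test.Holds]; omega, Wp.block ?_⟩
        simp [Straight, Instr.Legal, Instr.effect, State.setI, State.setR, k6, k30, k31, k33, kr, km,
          hA, hV, Finset.sum_range_succ, ← add_assoc]
        omega
      · rintro s3 - ⟨k30, k31, -⟩
        simp [Test.Holds, k30, k31]
      · rintro s3 hf3 ⟨-, -, k33, kr, km⟩
        exact ⟨hf3, k33, kr, km⟩
    · rintro s3 ⟨hf3, k33, kr, km⟩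
      have hf4 := hf2.trans hf3
      have k6 : s3.ireg 6 = 1 := by rw [hf4.ireg 6 (by norm_num), f6]
      have k21 : s3.ireg 21 = o + r := by rw [hf4.ireg 21 (by norm_num), f21]
      have k24 : s3.ireg 24 = o + m := by rw [hf4.ireg 24 (by norm_num), f24]
      refine Wp.block ?_
      simp [Straight, Instr.Legal, Instr.effect, State.setI, k6, k21, k24, k33, kr, km,
        update_writeBlock, ← add_assoc, Nat.succ_mul]
      omega
  · rintro s' - ⟨f21, f24, -⟩
    simp [Test.Holds, f21, f24]
  · rintro s' - ⟨f21, -, -, fm⟩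
    exact ⟨f21, fm⟩

/-- In the memory `mem`, the record at address `o` holds the vector `f 0, …, f (d - 1)` and its
product with the `m × d` matrix `G`, whose entries are stored row by row. The first two cells of the
record are left to other uses. -/
structure IsRecord (G : ℕ → ℝ) (d m : ℕ) (f : ℕ → ℝ) (o : ℕ) (mem : ℕ → ℝ) : Prop where
  vec : ∀ c < d, mem (o + 2 + c) = f c
  prod : ∀ r < m, mem (o + 2 + d + r) = ∑ c ∈ Finset.range d, G (r * d + c) * f c

theorem IsRecord.congr {G f mem mem' : ℕ → ℝ} {d m o : ℕ} (h : IsRecord G d m f o mem)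
    (hmem : ∀ a, o + 2 ≤ a → a < o + (d + m + 2) → mem' a = mem a) : IsRecord G d m f o mem' :=
  ⟨fun c hc => by rw [hmem _ (by omega) (by omega), h.vec c hc],
    fun r hr => by rw [hmem _ (by omega) (by omega), h.prod r hr]⟩

/-- Fills the record at the address in register `21` with the vector in the input buffer that starts
at the position in register `20`. Both registers are advanced to the next record and vector. -/
def recordProg : Prog :=
  .seq (block [.iadd 21 21 6, .iadd 21 21 6, .imove 19 21]) (.seq copyProg matVecProg)

theorem wp_record {G : ℕ → ℝ} {a o d m : ℕ} (h1 : s.ireg 1 = d) (h3 : s.ireg 3 = m)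
    (h6 : s.ireg 6 = 1) (h20 : s.ireg 20 = a) (h21 : s.ireg 21 = o) (ha : a + d ≤ S)
    (ho : o + (d + m + 2) ≤ S) (hm : m * d ≤ o) (hG : ∀ a < m * d, s.rmem a = G a) :
    Wp S ω recordProg (m * (8 * d + 9) + d * 6 + 11)
      (fun s' => Frame 19 20 s s' ∧ s'.ireg 20 = a + d ∧ s'.ireg 21 = o + (d + m + 2) ∧
        IsRecord G d m (fun k => s.input (a + k)) o s'.rmem ∧
        ∀ a, a < o + 2 ∨ o + (d + m + 2) ≤ a → s'.rmem a = s.rmem a) s := by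
  refine Wp.with_frame 19 20 ?_ rfl
  refine Wp.block_seq 19 20 (m * (8 * d + 9) + d * 6 + 7) (fun s' => s'.ireg 19 = o + 2 ∧
    s'.ireg 20 = a ∧ s'.ireg 21 = o + 2 ∧ s'.rmem = s.rmem) rfl ?_ ?_ (by simp; omega)
  · simp [Straight, Instr.Legal, Instr.effect, State.setI, *]
    omega
  rintro s1 hf1 ⟨e19, e20, e21, em⟩
  have e1 : s1.ireg 1 = d := by rw [hf1.ireg 1 (by norm_num), h1]
  have e3 : s1.ireg 3 = m := by rw [hf1.ireg 3 (by norm_num), h3]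
  have e6 : s1.ireg 6 = 1 := by rw [hf1.ireg 6 (by norm_num), h6]
  refine Wp.mono (Wp.seq (wp_copy e1 e6 e20 e21 ha (by omega)) ?_)
    (T := d * 6 + 3 + (m * (8 * d + 9) + 4)) (by omega) (fun _ h => h)
  rintro s2 ⟨hf2, e20', e21', em'⟩
  have hf := (hf1.mono (by norm_num) (by norm_num)).trans (hf2.mono (a' := 19) (b' := 20)
    (by norm_num) (by norm_num))
  refine Wp.mono (wp_matVec (by rw [hf.ireg 1 (by norm_num), h1])
    (by rw [hf.ireg 3 (by norm_num), h3]) (by rw [hf.ireg 6 (by norm_num), h6])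
    (by rw [hf2.ireg 19 (by norm_num), e19]) e21' le_rfl (by omega) (by omega)) le_rfl ?_
  rintro s3 ⟨hf3, k21, km⟩
  have hvec : ∀ c < d, s2.rmem (o + 2 + c) = s.input (a + c) := fun c hc => by
    rw [em', writeBlock_apply hc, hf1.input]
  have hmat : ∀ a < m * d, s2.rmem a = G a := fun a ha => by
    rw [em', writeBlock_of_notMem (by omega), em, hG a ha]
  refine ⟨by rw [hf3.ireg 20 (by norm_num), e20'], by rw [k21]; omega,
    ⟨fun c hc => ?_, fun r hr => ?_⟩, fun a ha => ?_⟩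
  · rw [km, writeBlock_of_notMem (by omega), hvec c hc]
  · rw [km, writeBlock_apply hr]
    refine Finset.sum_congr rfl fun c hc => ?_
    rw [Finset.mem_range] at hc
    rw [hvec c hc, hmat _ (row_index_lt hr hc)]
  · rw [km, writeBlock_of_notMem (by omega), em', writeBlock_of_notMem (by omega), em]

/-- Leaves in real register `20` the Euclidean distance of two vectors in the memory: the first one
occupies the addresses from register `20` up to register `22`, the second one starts at the address
in register `21`. -/
def distProg : Prog :=
  .seq (block [.rsub 20 20 20])
    (.seq
      (.loop (.ilt 20 22)
        (block [.rload 21 20, .rload 22 21, .rsub 21 21 22, .rmul 21 21 21, .radd 20 20 21,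
          .iadd 20 20 6, .iadd 21 21 6]))
      (block [.rsqrt 20 20]))

theorem wp_dist {a b l : ℕ} (h6 : s.ireg 6 = 1) (h20 : s.ireg 20 = a) (h21 : s.ireg 21 = b)
    (h22 : s.ireg 22 = a + l) (ha : a + l ≤ S) (hb : b + l ≤ S) :
    Wp S ω distProg (l * 9 + 5)
      (fun s' => Frame 20 20 s s' ∧ s'.rmem = s.rmem ∧ s'.rreg 20 =
        Real.sqrt (∑ c ∈ Finset.range l, (s.rmem (a + c) - s.rmem (b + c)) ^ 2)) s := by
  refine Wp.with_frame 20 20 ?_ rfl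
  refine Wp.block_seq 20 20 (l * 9 + 3) (fun s' => s'.ireg 20 = a ∧ s'.ireg 21 = b ∧
    s'.ireg 22 = a + l ∧ s'.rreg 20 = 0 ∧ s'.rmem = s.rmem) rfl ?_ ?_ (by simp; omega)
  · simp [Straight, Instr.Legal, Instr.effect, State.setR, *]
  rintro s1 hf1 ⟨e20, e21, e22, er, em⟩
  refine Wp.mono (Wp.seq (T := l * 9 + 1) (T' := 2) (Q' := fun s' => s'.rmem = s.rmem ∧
    s'.rreg 20 = ∑ c ∈ Finset.range l, (s.rmem (a + c) - s.rmem (b + c)) ^ 2) ?_ ?_)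
    (by omega) (fun _ h => h)
  · refine Wp.loop 20 20 l 8 (fun k s' => s'.ireg 20 = a + k ∧ s'.ireg 21 = b + k ∧
      s'.ireg 22 = a + l ∧ s'.rmem = s.rmem ∧
      s'.rreg 20 = ∑ c ∈ Finset.range k, (s.rmem (a + c) - s.rmem (b + c)) ^ 2) rfl
      ?_ ?_ ?_ (by omega) ?_
    · simp [e20, e21, e22, er, em]
    · rintro k hk s' hf ⟨f20, f21, f22, fm, fr⟩
      have f6 : s'.ireg 6 = 1 := by rw [hf.ireg 6 (by norm_num), hf1.ireg 6 (by norm_num), h6]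
      refine ⟨by simp only [Test.Holds]; omega, Wp.block ?_⟩
      simp [Straight, Instr.Legal, Instr.effect, State.setI, State.setR, f6, f20, f21, f22, fm, fr,
        Finset.sum_range_succ, ← add_assoc, sq]
      omega
    · rintro s' - ⟨f20, -, f22, -⟩
      simp [Test.Holds, f20, f22]
    · rintro s' - ⟨-, -, -, fm, fr⟩
      exact ⟨fm, fr⟩
  · rintro s2 ⟨fm, fr⟩
    refine Wp.block ⟨?_, ?_⟩
    · simp only [Instr.Legal, fr]
      positivity
    · simp [Straight, Instr.effect, State.setR, fm, fr]

end RealRAM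

/-! ### The update procedure -/

namespace OnlineMatching

open RealRAM

/-- The address of the record of the `i`-th offline point. The matrix comes first in the memory; it is
followed by the record of the current online point and by those of the offline points. -/
def recAddr (d m i : ℕ) : ℕ := m * d + (i + 1) * (d + m + 2)

theorem recAddr_succ (d m i : ℕ) : recAddr d m (i + 1) = recAddr d m i + (d + m + 2) := by
  unfold recAddr
  ring

theorem recAddr_add_le {d m i j : ℕ} (h : i < j) :
    recAddr d m i + (d + m + 2) ≤ recAddr d m j := by
  rw [← recAddr_succ]
  exact Nat.add_le_add_left (Nat.mul_le_mul_right _ (by omega)) _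

theorem le_recAddr (d m i : ℕ) : m * d + (d + m + 2) ≤ recAddr d m i := by
  unfold recAddr
  rw [Nat.succ_mul]
  omega

theorem recAddr_add_lt_of_ne {d m i j a : ℕ} (h : i ≠ j) (ha : a < d + m + 2) :
    recAddr d m i + a < recAddr d m j ∨ recAddr d m j + (d + m + 2) ≤ recAddr d m i + a := by
  rcases Nat.lt_or_gt_of_ne h with h | h
  · have := recAddr_add_le (d := d) (m := m) h
    omega
  · have := recAddr_add_le (d := d) (m := m) h
    omega

/-- The registers that hold the parameters of the data structure. -/
structure Params (n d m : ℕ) (s : State) : Prop where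
  dim : s.ireg 1 = d
  num : s.ireg 2 = n
  rows : s.ireg 3 = m
  base : s.ireg 4 = m * d
  size : s.ireg 5 = d + m + 2
  one : s.ireg 6 = 1

theorem Params.of_frame {n d m a b : ℕ} {s s' : State} (h : Params n d m s) (hf : Frame a b s s')
    (ha : 7 ≤ a) : Params n d m s' :=
  ⟨by rw [hf.ireg 1 (by omega), h.dim], by rw [hf.ireg 2 (by omega), h.num],
    by rw [hf.ireg 3 (by omega), h.rows], by rw [hf.ireg 4 (by omega), h.base],
    by rw [hf.ireg 5 (by omega), h.size], by rw [hf.ireg 6 (by omega), h.one]⟩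

/-- The contents of the memory between two requests: the matrix `G`, and for each offline point `X i`
its record, which starts with the exact and the sketched weight of the heaviest edge at `X i`. -/
structure Stored {n : ℕ} (d m : ℕ) (G : ℕ → ℝ) (X : Fin n → ℕ → ℝ) (w v : Fin n → ℝ)
    (mem : ℕ → ℝ) : Prop where
  mat : ∀ a < m * d, mem a = G a
  record : ∀ i : Fin n, IsRecord G d m (X i) (recAddr d m i) mem
  exact : ∀ i : Fin n, mem (recAddr d m i) = w i
  sketched : ∀ i : Fin n, mem (recAddr d m i + 1) = v i

variable {n d m : ℕ} {G : ℕ → ℝ} {X : Fin n → ℕ → ℝ} {w v : Fin n → ℝ} {mem : ℕ → ℝ}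

theorem Stored.congr {mem' : ℕ → ℝ} (h : Stored d m G X w v mem)
    (hm : ∀ a < m * d, mem' a = mem a)
    (hr : ∀ a, m * d + (d + m + 2) ≤ a → mem' a = mem a) : Stored d m G X w v mem' where
  mat a ha := by rw [hm a ha, h.mat a ha]
  record i := (h.record i).congr fun a ha _ => hr a (by have := le_recAddr d m i; omega)
  exact i := by rw [hr _ (le_recAddr d m i), h.exact i]
  sketched i := by rw [hr _ (by have := le_recAddr d m i; omega), h.sketched i]

theorem Stored.set_exact (h : Stored d m G X w v mem) (b : Fin n) (z : ℝ) :
    Stored d m G X (Function.update w b z) v (Function.update mem (recAddr d m b) z) where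
  mat a ha := by
    have := le_recAddr d m b
    rw [Function.update_of_ne (by omega), h.mat a ha]
  record i := (h.record i).congr fun a ha ha' => by
    refine Function.update_of_ne (fun e => ?_) _ _
    by_cases hib : (i : ℕ) = b
    · rw [hib] at ha
      omega
    · have := recAddr_add_lt_of_ne (d := d) (m := m) (a := 0) (Ne.symm hib) (by omega)
      omega
  exact i := by
    by_cases hib : i = b
    · subst hib
      simp
    · rw [Function.update_of_ne hib, Function.update_of_ne, h.exact i]
      have := recAddr_add_lt_of_ne (d := d) (m := m) (a := 0) (Fin.val_ne_of_ne hib) (by omega)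
      omega
  sketched i := by
    rw [Function.update_of_ne, h.sketched i]
    by_cases hib : (i : ℕ) = b
    · rw [hib]
      omega
    · have := recAddr_add_lt_of_ne (d := d) (m := m) (a := 1) hib (by omega)
      omega

theorem Stored.set_sketched (h : Stored d m G X w v mem) (b : Fin n) (z : ℝ) :
    Stored d m G X w (Function.update v b z) (Function.update mem (recAddr d m b + 1) z) where
  mat a ha := by
    have := le_recAddr d m b
    rw [Function.update_of_ne (by omega), h.mat a ha]
  record i := (h.record i).congr fun a ha ha' => by
    refine Function.update_of_ne (fun e => ?_) _ _
    by_cases hib : (i : ℕ) = b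
    · rw [hib] at ha
      omega
    · have := recAddr_add_lt_of_ne (d := d) (m := m) (a := 1) (Ne.symm hib) (by omega)
      omega
  exact i := by
    rw [Function.update_of_ne, h.exact i]
    by_cases hib : (i : ℕ) = b
    · rw [hib]
      omega
    · have := recAddr_add_lt_of_ne (d := d) (m := m) (a := 0) hib (by omega)
      omega
  sketched i := by
    by_cases hib : i = b
    · subst hib
      simp
    · rw [Function.update_of_ne hib, Function.update_of_ne, h.sketched i]
      have := recAddr_add_lt_of_ne (d := d) (m := m) (a := 1) (Fin.val_ne_of_ne hib) (by omega)
      omega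

/-- The Euclidean distance of the vectors `f 0, …, f (l - 1)` and `g 0, …, g (l - 1)`. -/
noncomputable def vecDist (l : ℕ) (f g : ℕ → ℝ) : ℝ :=
  Real.sqrt (∑ c ∈ Finset.range l, (f c - g c) ^ 2)

/-- The Euclidean distance of the products of the `m × d` matrix `G` with `f` and with `g`. -/
noncomputable def sketchDist (G : ℕ → ℝ) (d m : ℕ) (f g : ℕ → ℝ) : ℝ :=
  vecDist m (fun r => ∑ c ∈ Finset.range d, G (r * d + c) * f c)
    (fun r => ∑ c ∈ Finset.range d, G (r * d + c) * g c)

/-- The configurations between two requests. -/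
structure Ready {n : ℕ} (d m : ℕ) (G : ℕ → ℝ) (X : Fin n → ℕ → ℝ) (w v : Fin n → ℝ)
    (s : State) : Prop where
  params : Params n d m s
  total : s.rreg 1 = ∑ i, w i
  stored : Stored d m G X w v s.rmem

/-- One round of the search for the offline point with the largest gain in sketched weight. The record
of the point is at the address in register `10`, its number in register `11`; the best point so far is
in registers `12` (number) and `13` (address), its gain in real register `10`. -/
def searchStep : Prog :=
  .seq (block [.iadd 20 10 1, .iadd 20 20 6, .iadd 20 20 6, .iadd 21 4 1, .iadd 21 21 6,
      .iadd 21 21 6, .iadd 22 20 3])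
    (.seq distProg
      (.seq (block [.iadd 14 10 6, .rload 11 14, .rsub 20 20 11])
        (.seq
          (.ite (.rlt 10 20) (block [.rmove 10 20, .imove 12 11, .imove 13 10]) .skip)
          (block [.iadd 10 10 5, .iadd 11 11 6]))))

/-- Matches the online point in the input buffer. The search starts with the point `0` and gain `0`; if
no point has a positive gain, then it ends there, and any point is as good. -/
def updateProg : Prog :=
  .seq (block [.iconst 20 0, .imove 21 4])
    (.seq recordProg
      (.seq (block [.imove 10 21, .imove 13 21, .iconst 11 0, .iconst 12 0, .rsub 10 10 10])
        (.seq (.loop (.ilt 11 2) searchStep)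
          (.seq (block [.iadd 14 13 6, .rload 11 14, .radd 11 11 10, .rstore 14 11,
              .iadd 20 13 6, .iadd 20 20 6, .iadd 21 4 6, .iadd 21 21 6, .iadd 22 20 1])
            (.seq distProg
              (.seq (block [.rload 11 13])
                (.seq
                  (.ite (.rlt 11 20) (block [.rstore 13 20, .rsub 20 20 11, .radd 1 1 20]) .skip)
                  (block [.imove 0 12]))))))))

variable {S : ℕ} {ω : Coins} {s : State}

/-- The invariant of the search after `k` rounds; `gain` is the gain in sketched weight. Before the
first round the best point is the point `0` although its gain is not yet known, so that `bestGain`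
is an equality only at the end. -/
structure Searching (d m : ℕ) (gain : Fin n → ℝ) (M : ℕ → ℝ) (k : ℕ) (b : Fin n)
    (s : State) : Prop where
  addr : s.ireg 10 = recAddr d m k
  num : s.ireg 11 = k
  best : s.ireg 12 = b
  bestAddr : s.ireg 13 = recAddr d m b
  nonneg : 0 ≤ s.rreg 10
  bestGain : s.rreg 10 ≤ max 0 (gain b)
  max : ∀ i : Fin n, (i : ℕ) < k → gain i ≤ s.rreg 10
  mem : s.rmem = M

/-- What the machine computes from the images in two records. -/
theorem sketchDist_eq_of_isRecord {f g : ℕ → ℝ} {o o' : ℕ} (h : IsRecord G d m f o mem)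
    (h' : IsRecord G d m g o' mem) :
    √(∑ r ∈ Finset.range m, (mem (o + d + 2 + r) - mem (o' + d + 2 + r)) ^ 2) =
      sketchDist G d m f g := by
  unfold sketchDist vecDist
  congr 1
  refine Finset.sum_congr rfl fun r hr => ?_
  rw [Finset.mem_range] at hr
  beta_reduce
  rw [← h.prod r hr, ← h'.prod r hr, add_right_comm o, add_right_comm o']

/-- What the machine computes from the vectors in two records. -/
theorem vecDist_eq_of_isRecord {f g : ℕ → ℝ} {o o' : ℕ} (h : IsRecord G d m f o mem)
    (h' : IsRecord G d m g o' mem) :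
    √(∑ c ∈ Finset.range d, (mem (o + 2 + c) - mem (o' + 2 + c)) ^ 2) = vecDist d f g := by
  unfold vecDist
  congr 1
  refine Finset.sum_congr rfl fun r hr => ?_
  rw [Finset.mem_range] at hr
  rw [← h.vec r hr, ← h'.vec r hr]

theorem wp_searchStep {y : ℕ → ℝ} {b k : Fin n} (hP : Params n d m s)
    (hM : Stored d m G X w v mem) (hy : IsRecord G d m y (m * d) mem)
    (hS : recAddr d m n ≤ S) (hI : Searching d m (fun i => sketchDist G d m (X i) y - v i) mem k b s) :
    Wp S ω searchStep (9 * m + 25) (fun s' => ∃ b',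
      Searching d m (fun i => sketchDist G d m (X i) y - v i) mem (k + 1) b' s') s := by
  obtain ⟨e10, e11, e12, e13, e0, er, emax, em⟩ := hI
  have hk := recAddr_add_le (d := d) (m := m) k.2
  have hk0 := le_recAddr d m k
  refine Wp.block_seq 20 20 (9 * m + 17) (fun s' => s'.ireg 20 = recAddr d m k + d + 2 ∧
    s'.ireg 21 = m * d + d + 2 ∧ s'.ireg 22 = recAddr d m k + d + 2 + m ∧ s'.rmem = mem) rfl ?_ ?_
    (by simp; omega)
  · simp [Straight, Instr.Legal, Instr.effect, State.setI, e10, em, hP.dim, hP.one, hP.base, hP.rows]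
    omega
  rintro s1 hf1 ⟨f20, f21, f22, fm⟩
  refine Wp.mono (Wp.seq (T := m * 9 + 5) (T' := 12) (wp_dist (hP.of_frame hf1 (by norm_num)).one
    f20 f21 f22 (by omega) (by omega)) ?_) (by omega) fun _ h => h
  rintro s2 ⟨hf2, gm, gr⟩
  rw [fm] at gm gr
  have hf := hf1.trans hf2
  rw [sketchDist_eq_of_isRecord (hM.record k) hy] at gr
  have g10 : s2.ireg 10 = recAddr d m k := by rw [hf.ireg 10 (by norm_num), e10]
  refine Wp.block_seq 14 11 8 (fun s' => s'.rmem = mem ∧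
    s'.rreg 20 = sketchDist G d m (X k) y - v k) rfl ?_ ?_ (by simp)
  · simp [Straight, Instr.Legal, Instr.effect, State.setI, State.setR, g10, gm, gr,
      (hP.of_frame hf (by norm_num)).one, hM.sketched]
    omega
  rintro s3 hf3 ⟨km, kr⟩
  have hf' := (hf.mono (a' := 14) (b' := 11) (by norm_num) (by norm_num)).trans hf3
  refine Wp.mono (Wp.seq (T := 5) (T' := 3) (Q' := fun s' => Params n d m s' ∧ ∃ b' : Fin n,
    s'.ireg 10 = recAddr d m k ∧ s'.ireg 11 = k ∧ s'.ireg 12 = b' ∧ s'.ireg 13 = recAddr d m b' ∧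
    0 ≤ s'.rreg 10 ∧ s'.rreg 10 ≤ max 0 (sketchDist G d m (X b') y - v b') ∧
    (∀ i : Fin n, (i : ℕ) < k + 1 → sketchDist G d m (X i) y - v i ≤ s'.rreg 10) ∧
    s'.rmem = mem) ?_ ?_) (by norm_num) fun _ h => h
  · have k10 : s3.ireg 10 = recAddr d m k := by rw [hf'.ireg 10 (by norm_num), e10]
    have k11 : s3.ireg 11 = k := by rw [hf'.ireg 11 (by norm_num), e11]
    have kr10 : s3.rreg 10 = s.rreg 10 := hf'.rreg 10 (by norm_num)
    have kP := hP.of_frame hf' (by norm_num)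
    refine Wp.ite (T := 4) (fun hb => ?_) fun hb => ?_
    · simp only [Test.Holds, kr, kr10] at hb
      have hpos := e0.trans hb.le
      refine Wp.mono ((Wp.block (Q := fun s' => s'.ireg 10 = recAddr d m k ∧ s'.ireg 11 = k ∧
        s'.ireg 12 = k ∧ s'.ireg 13 = recAddr d m k ∧
        s'.rreg 10 = sketchDist G d m (X k) y - v k ∧ s'.rmem = mem) ?_).with_frame 10 10 rfl)
        le_rfl ?_
      · simp [Straight, Instr.Legal, Instr.effect, State.setI, State.setR, k10, k11, km, kr]
      rintro s4 ⟨hf4, l10, l11, l12, l13, lr, lm⟩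
      refine ⟨kP.of_frame hf4 (by norm_num), k, l10, l11, l12, l13, by rw [lr]; exact hpos,
        by rw [lr]; exact le_max_right _ _, fun i hi => ?_, lm⟩
      rw [lr]
      rcases Nat.lt_succ_iff_lt_or_eq.1 hi with hi | hi
      · exact (emax i hi).trans hb.le
      · rw [Fin.ext hi]
    · simp only [Test.Holds, kr, kr10, not_lt] at hb
      refine (Wp.skip ⟨kP, b, k10, k11, ?_, ?_, by rw [kr10]; exact e0,
        by rw [kr10]; exact er, fun i hi => ?_, km⟩).mono (by norm_num)
        fun _ h => h
      · rw [hf'.ireg 12 (by norm_num), e12]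
      · rw [hf'.ireg 13 (by norm_num), e13]
      · rw [kr10]
        rcases Nat.lt_succ_iff_lt_or_eq.1 hi with hi | hi
        · exact emax i hi
        · rw [Fin.ext hi]
          exact hb
  · rintro s4 ⟨lP, b', l10, l11, l12, l13, l0, lr, lmax, lm⟩
    refine (Wp.block (Q := fun s' => s'.ireg 10 = recAddr d m (k + 1) ∧ s'.ireg 11 = k + 1 ∧
      s'.ireg 12 = b' ∧ s'.ireg 13 = recAddr d m b' ∧ s'.rreg 10 = s4.rreg 10 ∧
      s'.rmem = mem) ?_).mono le_rfl ?_
    · have := le_recAddr d m n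
      have hkn := k.2
      have hnS : n ≤ recAddr d m n := by
        unfold recAddr
        nlinarith
      simp [Straight, Instr.Legal, Instr.effect, State.setI, l10, l11, l12, l13, lm, lP.size, lP.one,
        recAddr_succ]
      omega
    · rintro s5 ⟨o10, o11, o12, o13, or', om⟩
      exact ⟨b', o10, o11, o12, o13, by rwa [or'], by rwa [or'], by rwa [or'], om⟩

/-- An update chooses an offline point `b` with the largest gain in sketched weight, and raises the two
weights of `b` to those of the new edge. -/
theorem wp_update [NeZero n] (hR : Ready d m G X w v s) (hS : recAddr d m n ≤ S) :
    Wp S ω updateProg (m * (8 * d + 9) + d * 15 + n * (9 * m + 26) + 50) (fun s' => ∃ b : Fin n,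
      s'.ireg 0 = b ∧
      Ready d m G X (Function.update w b (max (w b) (vecDist d (X b) s.input)))
        (Function.update v b (max (v b) (sketchDist G d m (X b) s.input))) s' ∧
      ∀ i, sketchDist G d m (X i) s.input - v i ≤
        max 0 (sketchDist G d m (X b) s.input - v b)) s := by
  obtain ⟨hP, htot, hM⟩ := hR
  set y := s.input with hy
  set gain : Fin n → ℝ := fun i => sketchDist G d m (X i) y - v i with hgain
  have hS0 := recAddr_add_le (d := d) (m := m) (Nat.pos_of_neZero n)
  have hS1 := le_recAddr d m 0
  refine Wp.block_seq 10 10 (m * (8 * d + 9) + d * 15 + n * (9 * m + 26) + 47) (fun s' =>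
    s'.ireg 20 = 0 ∧ s'.ireg 21 = m * d ∧ s'.rmem = s.rmem) rfl ?_ ?_ (by simp; omega)
  · simp [Straight, Instr.Legal, Instr.effect, State.setI, hP.base]
  rintro s1 hf1 ⟨e20, e21, em⟩
  have eP := hP.of_frame hf1 (by norm_num)
  refine Wp.mono (Wp.seq (wp_record (G := G) eP.dim eP.rows eP.one e20 e21 (by omega) (by omega)
    le_rfl (by rw [em]; exact hM.mat)) (T' := d * 9 + n * (9 * m + 26) + 36) ?_) (by omega)
    fun _ h => h
  rintro s2 ⟨hf2, -, f21, frec, fmem⟩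
  rw [em] at fmem
  simp only [zero_add, hf1.input, ← hy] at frec
  have hf := hf1.trans (hf2.mono (a' := 10) (b' := 10) (by norm_num) (by norm_num))
  have fP := hP.of_frame hf (by norm_num)
  have fM : Stored d m G X w v s2.rmem :=
    hM.congr (fun a ha => fmem a (by omega)) fun a ha => fmem a (by omega)
  set M := s2.rmem with hMdef
  have hr0 : m * d + (d + m + 2) = recAddr d m 0 := by simp [recAddr]
  refine Wp.block_seq 10 10 (d * 9 + n * (9 * m + 26) + 30) (Searching d m gain M 0 0)
    rfl ?_ ?_ (by simp; omega)
  · simp only [Straight, Instr.Legal, Instr.effect, State.setI, State.setR]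
    refine ⟨trivial, trivial, by omega, by omega, trivial, ?_⟩
    refine ⟨?_, ?_, ?_, ?_, ?_, ?_, by simp, ?_⟩ <;> simp [f21, hr0, ← hMdef]
  rintro s3 hf3 hI
  refine Wp.mono (Wp.seq (T := n * (9 * m + 26) + 1) (T' := d * 9 + 29)
    (Q' := fun s' => Frame 10 10 s3 s' ∧ ∃ b, Searching d m gain M n b s')
    (Wp.loop 10 10 n (9 * m + 25) (fun k s' => ∃ b, Searching d m gain M k b s') rfl ⟨0, hI⟩
      ?_ ?_ le_rfl fun s' hf hI => ⟨hf, hI⟩) ?_) (by omega) fun _ h => h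
  · rintro k hk s' hf' ⟨b, hI⟩
    have hP' := (fP.of_frame hf3 (by norm_num)).of_frame hf' (by norm_num)
    refine ⟨by simp only [Test.Holds, hI.num, hP'.num, hk], ?_⟩
    exact wp_searchStep (k := ⟨k, hk⟩) hP' fM frec hS hI
  · rintro s' hf' ⟨b, hI⟩
    have hP' := (fP.of_frame hf3 (by norm_num)).of_frame hf' (by norm_num)
    simp [Test.Holds, hI.num, hP'.num]
  rintro s4 ⟨hf4, b, ⟨-, -, g12, g13, g0, gr', gmax', gm⟩⟩
  have gr : s4.rreg 10 = max 0 (gain b) := le_antisymm gr' (max_le g0 (gmax' b b.2))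
  have gmax := gmax'
  rw [gr] at gmax
  have hf5 := (hf.trans hf3).trans hf4
  have gP := hP.of_frame hf5 (by norm_num)
  have hb := recAddr_add_le (d := d) (m := m) b.2
  have hb0 := le_recAddr d m b
  -- The sketched weight grows by the positive part of the gain.
  have hv : v b + max 0 (gain b) = max (v b) (sketchDist G d m (X b) y) := by
    rw [hgain, ← max_add_add_left]
    simp
  set M' := Function.update M (recAddr d m b + 1) (max (v b) (sketchDist G d m (X b) y)) with hM'
  have hSt := fM.set_sketched b (max (v b) (sketchDist G d m (X b) y))
  rw [← hM'] at hSt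
  have hrec : IsRecord G d m y (m * d) M' :=
    frec.congr fun a ha ha' => Function.update_of_ne (by omega) _ _
  refine Wp.block_seq 10 10 (d * 9 + 19) (fun s' => s'.ireg 12 = b ∧ s'.ireg 13 = recAddr d m b ∧
    s'.ireg 20 = recAddr d m b + 2 ∧ s'.ireg 21 = m * d + 2 ∧ s'.ireg 22 = recAddr d m b + 2 + d ∧
    s'.rmem = M') rfl ?_ ?_ (by simp; omega)
  · simp [Straight, Instr.Legal, Instr.effect, State.setI, State.setR, g12, g13, gr, gm, gP.one,
      gP.base, gP.dim, fM.sketched, hv, hM']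
    omega
  rintro s5 hf6 ⟨k12, k13, k20, k21, k22, km⟩
  have hf7 := hf5.trans hf6
  have kP := hP.of_frame hf7 (by norm_num)
  refine Wp.mono (Wp.seq (T := d * 9 + 5) (T' := 14) (wp_dist kP.one k20 k21 k22 (by omega)
    (by omega)) ?_) (by omega) fun _ h => h
  rintro s6 ⟨hf8, lm, lr⟩
  rw [km] at lm lr
  rw [vecDist_eq_of_isRecord (hSt.record b) hrec] at lr
  have hf9 := hf7.trans (hf8.mono (a' := 10) (b' := 10) (by norm_num) (by norm_num))
  have l12 : s6.ireg 12 = b := by rw [hf8.ireg 12 (by norm_num), k12]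
  have l13 : s6.ireg 13 = recAddr d m b := by rw [hf8.ireg 13 (by norm_num), k13]
  refine Wp.block_seq 20 10 12 (fun s' => s'.rmem = M' ∧ s'.rreg 11 = w b ∧
    s'.rreg 20 = vecDist d (X b) y) rfl ?_ ?_ (by simp)
  · simp [Straight, Instr.Legal, Instr.effect, State.setR, l13, lm, lr, hSt.exact]
    omega
  rintro s7 hf10 ⟨om, or11, or20⟩
  have hf11 := hf9.trans (hf10.mono (a' := 10) (b' := 10) (by norm_num) (by norm_num))
  have o12 : s7.ireg 12 = b := by rw [hf10.ireg 12 (by norm_num), l12]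
  have o13 : s7.ireg 13 = recAddr d m b := by rw [hf10.ireg 13 (by norm_num), l13]
  have otot : s7.rreg 1 = ∑ i, w i := by rw [hf11.rreg 1 (by norm_num), htot]
  have oP := hP.of_frame hf11 (by norm_num)
  refine Wp.mono (Wp.seq (T := 5) (T' := 2) (Q' := fun s' => s'.ireg 12 = b ∧
    Ready d m G X (Function.update w b (max (w b) (vecDist d (X b) y)))
        (Function.update v b (max (v b) (sketchDist G d m (X b) y))) s') ?_ ?_)
    (by norm_num) fun _ h => h
  · refine Wp.ite (T := 4) (fun hlt => ?_) fun hlt => ?_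
    · simp only [Test.Holds, or11, or20] at hlt
      rw [max_eq_right hlt.le]
      refine Wp.mono ((Wp.block (Q := fun s' =>
        s'.rreg 1 = (∑ i, w i) + (vecDist d (X b) y - w b) ∧
        s'.rmem = Function.update M' (recAddr d m b) (vecDist d (X b) y)) ?_).with_frame 20 1 rfl)
        le_rfl ?_
      · simp [Straight, Instr.Legal, Instr.effect, State.setR, o13, om, or11, or20, otot]
        omega
      rintro s8 ⟨hf12, pr, pm⟩
      refine ⟨by rw [hf12.ireg 12 (by norm_num), o12], oP.of_frame hf12 (by norm_num), ?_, ?_⟩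
      · rw [pr, Finset.sum_update_of_mem (Finset.mem_univ b),
          Finset.sum_eq_add_sum_sdiff_singleton_of_mem (Finset.mem_univ b) w]
        ring
      · rw [pm]
        exact hSt.set_exact b _
    · simp only [Test.Holds, or11, or20, not_lt] at hlt
      rw [max_eq_left hlt, Function.update_eq_self]
      exact (Wp.skip ⟨o12, oP, otot, by rw [om]; exact hSt⟩).mono (by norm_num) fun _ h => h
  · rintro s8 ⟨p12, hR⟩
    refine (Wp.block (Q := fun s' => s'.ireg 0 = b ∧ Params n d m s' ∧ s'.rreg = s8.rreg ∧
      s'.rmem = s8.rmem) ?_).mono le_rfl ?_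
    · obtain ⟨p1, p2, p3, p4, p5, p6⟩ := hR.params
      refine ⟨trivial, by simp [Instr.effect, State.setI, p12], ?_, rfl, rfl⟩
      constructor <;> simp [Instr.effect, State.setI, *]
    · rintro s9 ⟨q0, qP, qr, qm⟩
      exact ⟨b, q0, ⟨qP, by rw [qr, hR.total], by rw [qm]; exact hR.stored⟩, fun i => gmax i i.2⟩

end OnlineMatching

/-! ### The initialization procedure -/

namespace OnlineMatching

open RealRAM

theorem isRecord_congr_vec {G f g mem : ℕ → ℝ} {d m o : ℕ} (h : IsRecord G d m f o mem)
    (hfg : ∀ c < d, f c = g c) : IsRecord G d m g o mem :=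
  ⟨fun c hc => by rw [h.vec c hc, hfg c hc], fun r hr => by
    rw [h.prod r hr]
    exact Finset.sum_congr rfl fun c hc => by rw [hfg c (Finset.mem_range.1 hc)]⟩

/-- An upper bound for the binary logarithm of `2 n / δ` that the machine can compute by doubling. -/
noncomputable def logCount (n : ℕ) (δ : ℝ) : ℕ := ⌈Real.logb 2 (2 * n / δ)⌉₊

/-- The number of rows of the random matrix. -/
noncomputable def rowCount (n : ℕ) (ε δ : ℝ) : ℕ := ⌈(logCount n δ : ℝ) * 32 / ε / ε⌉₊

/-- The number of memory cells of each kind. The summand `32` makes room for the constants of the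
program. -/
noncomputable def cellCount (n d : ℕ) (ε δ : ℝ) : ℕ := recAddr d (rowCount n ε δ) n + 32

/-- The random sign that is determined by the `k`-th coin flip. -/
noncomputable def sign (ω : Coins) (k : ℕ) : ℝ := if ω k then 1 else -1

theorem lt_logCount_iff {n k : ℕ} {δ : ℝ} (hn : 1 ≤ n) (hδ : 0 < δ) :
    k < logCount n δ ↔ (2 : ℝ) ^ k < 2 * n / δ := by
  have hn' : (0 : ℝ) < n := by exact_mod_cast hn
  rw [logCount, Nat.lt_ceil, Real.lt_logb_iff_rpow_lt (by norm_num) (by positivity),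
    Real.rpow_natCast]

theorem initInput_eq_pointInput {n d : ℕ} (ε δ : ℝ) (x : Fin n → EuclideanSpace ℝ (Fin d))
    (i : Fin n) {c : ℕ} (hc : c < d) :
    initInput ε δ x (2 + i * d + c) = pointInput (x i) c := by
  have hlt := row_index_lt i.2 hc
  rw [show 2 + (i : ℕ) * d + c = (i * d + c) + 2 by omega]
  simp only [initInput, pointInput, dif_pos hlt, dif_pos hc]
  have : (⟨i * d + c, hlt⟩ : Fin (n * d)) = finProdFinEquiv (i, ⟨c, hc⟩) := by
    ext
    simp [finProdFinEquiv]
    ring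
  rw [this, Equiv.symm_apply_apply]

variable {n d : ℕ} {ε δ : ℝ} {ω : Coins} {s : State}

/-- Computes the number of rows in register `12`: first `logCount` by doubling, in real register `14`,
and then the ceiling of the quotient by counting. -/
def rowCountProg : Prog :=
  .seq (block [.imove 2 0, .iconst 6 1, .iconst 10 0, .rinput 10 10, .rinput 11 6, .rcast 12 6,
      .rcast 13 2, .radd 13 13 13, .rdiv 13 13 11, .rsub 14 14 14, .rmove 15 12])
    (.seq (.loop (.rlt 15 13) (block [.radd 15 15 15, .radd 14 14 12]))
      (.seq (block [.iconst 11 32, .rcast 16 11, .rmul 14 14 16, .rdiv 14 14 10, .rdiv 14 14 10,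
          .rsub 15 15 15, .iconst 12 0])
        (.loop (.rlt 15 14) (block [.iadd 12 12 6, .radd 15 15 12]))))

theorem wp_rowCount {S : ℕ} (hn : 1 ≤ n) (hε : ε ≠ 0) (hδ : 0 < δ) (h0 : s.ireg 0 = n)
    (hi0 : s.input 0 = ε) (hi1 : s.input 1 = δ) (hS : rowCount n ε δ ≤ S) (hS' : 32 ≤ S) :
    Wp S ω rowCountProg (4 * logCount n δ + 4 * rowCount n ε δ + 22)
      (fun s' => Frame 2 10 s s' ∧ s'.ireg 2 = n ∧ s'.ireg 6 = 1 ∧ s'.ireg 12 = rowCount n ε δ ∧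
        s'.rreg 12 = 1 ∧ s'.rmem = s.rmem ∧ s'.flips = s.flips) s := by
  refine Wp.with_frame 2 10 ?_ rfl
  refine Wp.block_seq 2 10 (4 * logCount n δ + 4 * rowCount n ε δ + 10) (fun s' => s'.ireg 2 = n ∧
    s'.ireg 6 = 1 ∧ s'.rreg 10 = ε ∧ s'.rreg 12 = 1 ∧ s'.rreg 13 = 2 * n / δ ∧ s'.rreg 14 = 0 ∧
    s'.rreg 15 = 1 ∧ s'.rmem = s.rmem ∧ s'.flips = s.flips) rfl ?_ ?_ (by simp; omega)
  · simp [Straight, Instr.Legal, Instr.effect, State.setI, State.setR, h0, hi0, hi1, hδ.ne',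
      two_mul]
    omega
  rintro s1 - ⟨e2, e6, er10, er12, er13, er14, er15, em, ef⟩
  refine Wp.mono (Wp.seq (T := 4 * logCount n δ + 1) (T' := 4 * rowCount n ε δ + 9)
    (Q' := fun s' => Frame 10 14 s1 s' ∧ s'.rreg 14 = logCount n δ ∧ s'.rmem = s.rmem ∧
      s'.flips = s.flips)
    (Wp.loop 10 14 (logCount n δ) 3 (fun k s' => s'.rreg 14 = k ∧ s'.rreg 15 = 2 ^ k ∧
      s'.rmem = s.rmem ∧ s'.flips = s.flips) rfl (by simp [*]) ?_ ?_ (by omega) ?_) ?_) (by omega)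
    fun _ h => h
  · rintro k hk s2 hf ⟨f14, f15, fm, ff⟩
    rw [lt_logCount_iff hn hδ] at hk
    have f12 : s2.rreg 12 = 1 := by rw [hf.rreg 12 (by norm_num), er12]
    have f13 : s2.rreg 13 = 2 * n / δ := by rw [hf.rreg 13 (by norm_num), er13]
    refine ⟨by simpa only [Test.Holds, f13, f15] using hk, Wp.block ?_⟩
    simp [Straight, Instr.Legal, Instr.effect, State.setR, f12, f14, f15, fm, ff, pow_succ, mul_two]
  · rintro s2 hf ⟨-, f15, -⟩
    have f13 : s2.rreg 13 = 2 * n / δ := by rw [hf.rreg 13 (by norm_num), er13]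
    have := (lt_logCount_iff (k := logCount n δ) hn hδ).not.1 (lt_irrefl _)
    simpa only [Test.Holds, f13, f15] using this
  · rintro s2 hf ⟨f14, -, fm, ff⟩
    exact ⟨hf, f14, fm, ff⟩
  rintro s2 ⟨hf, f14, fm, ff⟩
  have f2 : s2.ireg 2 = n := by rw [hf.ireg 2 (by norm_num), e2]
  have f6 : s2.ireg 6 = 1 := by rw [hf.ireg 6 (by norm_num), e6]
  have f10 : s2.rreg 10 = ε := by rw [hf.rreg 10 (by norm_num), er10]
  have f12 : s2.rreg 12 = 1 := by rw [hf.rreg 12 (by norm_num), er12]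
  refine Wp.block_seq 10 10 (4 * rowCount n ε δ + 1) (fun s' => s'.ireg 12 = 0 ∧ s'.rreg 12 = 1 ∧
    s'.rreg 14 = logCount n δ * 32 / ε / ε ∧ s'.rreg 15 = 0 ∧ s'.rmem = s.rmem ∧
    s'.flips = s.flips) rfl ?_ ?_ (by simp; omega)
  · simp [Straight, Instr.Legal, Instr.effect, State.setI, State.setR, f10, f12, f14, fm, ff, hε, hS']
  rintro s3 hf3 ⟨g12, gr12, gr14, gr15, gm, gf⟩
  refine Wp.loop 10 15 (rowCount n ε δ) 3 (fun k s' => s'.ireg 12 = k ∧ s'.rreg 15 = k ∧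
    s'.rmem = s.rmem ∧ s'.flips = s.flips) rfl (by simp [*]) ?_ ?_ (by omega) ?_
  · rintro k hk s4 hf4 ⟨k12, k15, km, kf⟩
    have k6 : s4.ireg 6 = 1 := by rw [hf4.ireg 6 (by norm_num), hf3.ireg 6 (by norm_num), f6]
    have kr12 : s4.rreg 12 = 1 := by rw [hf4.rreg 12 (by norm_num), gr12]
    have kr14 : s4.rreg 14 = logCount n δ * 32 / ε / ε := by rw [hf4.rreg 14 (by norm_num), gr14]
    refine ⟨?_, Wp.block ?_⟩
    · rw [rowCount, Nat.lt_ceil] at hk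
      simpa only [Test.Holds, k15, kr14] using hk
    · simp [Straight, Instr.Legal, Instr.effect, State.setI, State.setR, k6, k12, k15, kr12, km, kf]
      omega
  · rintro s4 hf4 ⟨-, k15, -⟩
    have kr14 : s4.rreg 14 = logCount n δ * 32 / ε / ε := by rw [hf4.rreg 14 (by norm_num), gr14]
    simp only [Test.Holds, k15, kr14, not_lt]
    exact Nat.le_ceil _
  · rintro s4 hf4 ⟨k12, -, km, kf⟩
    have hf5 := hf3.trans (hf4.mono (a' := 10) (b' := 10) (by norm_num) (by norm_num))
    exact ⟨by rw [hf5.ireg 2 (by norm_num), f2], by rw [hf5.ireg 6 (by norm_num), f6], k12,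
      by rw [hf4.rreg 12 (by norm_num), gr12], km, kf⟩

/-- Draws the random matrix, row by row from address `0` on, and sets the remaining parameters. The
number of entries is computed by repeated addition. -/
def matrixProg : Prog :=
  .seq (block [.imove 3 12, .iconst 12 0, .iconst 13 0])
    (.seq (.loop (.ilt 12 3) (block [.iadd 13 13 1, .iadd 12 12 6]))
      (.seq (block [.imove 4 13, .iadd 5 1 3, .iadd 5 5 6, .iadd 5 5 6, .iconst 22 0])
        (.loop (.ilt 22 13)
          (block [.coin 20, .rcast 20 20, .radd 20 20 20, .rsub 20 20 12, .rstore 22 20,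
            .iadd 22 22 6]))))

theorem wp_matrix {S m : ℕ} (h1 : s.ireg 1 = d) (h2 : s.ireg 2 = n) (h6 : s.ireg 6 = 1)
    (h12 : s.ireg 12 = m) (hr12 : s.rreg 12 = 1) (hflips : s.flips = 0)
    (hS : m * d + (d + m + 2) ≤ S) :
    Wp S ω matrixProg (8 * (m * d) + 4 * m + 12)
      (fun s' => Frame 3 10 s s' ∧ Params n d m s' ∧
        s'.rmem = writeBlock s.rmem 0 (m * d) (sign ω)) s := by
  refine Wp.with_frame 3 10 ?_ rfl
  refine Wp.block_seq 3 20 (8 * (m * d) + 4 * m + 8) (fun s' => s'.ireg 3 = m ∧ s'.ireg 6 = 1 ∧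
    s'.ireg 12 = 0 ∧ s'.ireg 13 = 0 ∧ s'.rmem = s.rmem ∧ s'.flips = 0) rfl ?_ ?_ (by simp; omega)
  · simp [Straight, Instr.Legal, Instr.effect, State.setI, h6, h12, hflips]
  rintro s1 hf1 ⟨e3, e6, e12, e13, em, ef⟩
  refine Wp.mono (Wp.seq (T := 4 * m + 1) (T' := 8 * (m * d) + 7) (Q' := fun s' =>
    Frame 10 20 s1 s' ∧ s'.ireg 13 = m * d ∧ s'.rmem = s.rmem ∧ s'.flips = 0)
    (Wp.loop 10 20 m 3 (fun k s' => s'.ireg 12 = k ∧ s'.ireg 13 = k * d ∧ s'.rmem = s.rmem ∧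
      s'.flips = 0) rfl (by simp [*]) ?_ ?_ (by omega) ?_) ?_) (by omega) fun _ h => h
  · rintro k hk s2 hf ⟨f12, f13, fm, ff⟩
    have f1 : s2.ireg 1 = d := by rw [hf.ireg 1 (by norm_num), hf1.ireg 1 (by norm_num), h1]
    have f3 : s2.ireg 3 = m := by rw [hf.ireg 3 (by norm_num), e3]
    have f6 : s2.ireg 6 = 1 := by rw [hf.ireg 6 (by norm_num), e6]
    have : k * d + d ≤ m * d := by
      rw [← Nat.succ_mul]
      exact Nat.mul_le_mul_right d hk
    refine ⟨by simpa only [Test.Holds, f12, f3] using hk, Wp.block ?_⟩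
    simp [Straight, Instr.Legal, Instr.effect, State.setI, f1, f6, f12, f13, fm, ff, Nat.succ_mul]
    omega
  · rintro s2 hf ⟨f12, -⟩
    have f3 : s2.ireg 3 = m := by rw [hf.ireg 3 (by norm_num), e3]
    simp [Test.Holds, f12, f3]
  · rintro s2 hf ⟨-, f13, fm, ff⟩
    exact ⟨hf, f13, fm, ff⟩
  rintro s2 ⟨hf2, f13, fm, ff⟩
  have f1 : s2.ireg 1 = d := by rw [hf2.ireg 1 (by norm_num), hf1.ireg 1 (by norm_num), h1]
  have f2 : s2.ireg 2 = n := by rw [hf2.ireg 2 (by norm_num), hf1.ireg 2 (by norm_num), h2]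
  have f3 : s2.ireg 3 = m := by rw [hf2.ireg 3 (by norm_num), e3]
  have f6 : s2.ireg 6 = 1 := by rw [hf2.ireg 6 (by norm_num), e6]
  refine Wp.block_seq 4 20 (8 * (m * d) + 1) (fun s' => Params n d m s' ∧ s'.ireg 13 = m * d ∧
    s'.ireg 22 = 0 ∧ s'.rmem = s.rmem ∧ s'.flips = 0) rfl ?_ ?_ (by simp; omega)
  · simp only [Straight, Instr.Legal, Instr.effect, State.setI]
    refine ⟨trivial, ?_, ?_, ?_, by omega, ⟨?_, ?_, ?_, ?_, ?_, ?_⟩, ?_⟩ <;>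
      simp [f1, f2, f3, f6, f13, fm, ff] <;> omega
  rintro s3 hf3 ⟨gP, g13, g22, gm, gf⟩
  refine Wp.loop 20 20 (m * d) 7 (fun k s' => s'.ireg 22 = k ∧
    s'.rmem = writeBlock s.rmem 0 k (sign ω) ∧ s'.flips = k) rfl
    (by simp [g22, gm, gf, writeBlock_zero]) ?_ ?_ (by omega) ?_
  · -- A coin `b` becomes the sign `b + b - 1`.
    rintro k hk s4 hf4 ⟨k22, km, kf⟩
    have k6 : s4.ireg 6 = 1 := (gP.of_frame hf4 (by norm_num)).one
    have k13 : s4.ireg 13 = m * d := by rw [hf4.ireg 13 (by norm_num), g13]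
    have kr12 : s4.rreg 12 = 1 := by
      rw [hf4.rreg 12 (by norm_num), hf3.rreg 12 (by norm_num), hf2.rreg 12 (by norm_num),
        hf1.rreg 12 (by norm_num), hr12]
    have hsign : ((if ω k then 1 else 0 : ℕ) : ℝ) + ((if ω k then 1 else 0 : ℕ) : ℝ) - 1 =
        sign ω k := by
      unfold sign
      split_ifs <;> norm_num
    refine ⟨by simpa only [Test.Holds, k22, k13] using hk, Wp.block ?_⟩
    simp only [Straight, Instr.Legal, Instr.effect, State.setI, State.setR]
    refine ⟨trivial, trivial, trivial, trivial, ?_, ?_, ?_, ?_, ?_⟩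
    · simp [k22]
      omega
    · simp [k22, k6]
      omega
    · simp [k22, k6]
    · rw [← update_writeBlock, zero_add, ← hsign]
      simp [k22, km, kf, kr12]
    · simp [kf]
  · rintro s4 hf4 ⟨k22, -⟩
    have k13 : s4.ireg 13 = m * d := by rw [hf4.ireg 13 (by norm_num), g13]
    simp [Test.Holds, k22, k13]
  · rintro s4 hf4 ⟨-, km, -⟩
    exact ⟨gP.of_frame hf4 (by norm_num), km⟩

/-- Writes the records of the offline points. -/
def recordsProg : Prog :=
  .seq (block [.iconst 20 2, .iadd 21 4 5, .iconst 12 0])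
    (.loop (.ilt 12 2) (.seq recordProg (block [.iadd 12 12 6])))

theorem wp_records {S m : ℕ} {G : ℕ → ℝ} (x : Fin n → EuclideanSpace ℝ (Fin d))
    (hP : Params n d m s) (htot : s.rreg 1 = 0) (hinput : s.input = initInput ε δ x)
    (hmem : s.rmem = writeBlock (fun _ => 0) 0 (m * d) G) (hS : recAddr d m n ≤ S) (hS' : 2 ≤ S) :
    Wp S ω recordsProg (n * (m * (8 * d + 9) + d * 6 + 14) + 5)
      (Ready d m G (fun i => pointInput (x i)) (fun _ => 0) fun _ => 0) s := by
  have hn0 := le_recAddr d m n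
  refine Wp.block_seq 10 10 (n * (m * (8 * d + 9) + d * 6 + 14) + 1) (fun s' => s'.ireg 12 = 0 ∧
    s'.ireg 20 = 2 ∧ s'.ireg 21 = recAddr d m 0 ∧ s'.rmem = s.rmem) rfl ?_ ?_ (by simp; omega)
  · simp [Straight, Instr.Legal, Instr.effect, State.setI, hP.base, hP.size, recAddr, hS']
    omega
  rintro s1 hf1 ⟨e12, e20, e21, em⟩
  have eP := hP.of_frame hf1 (by norm_num)
  refine Wp.loop 10 10 n (m * (8 * d + 9) + d * 6 + 13) (fun k s' => s'.ireg 12 = k ∧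
    s'.ireg 20 = 2 + k * d ∧ s'.ireg 21 = recAddr d m k ∧ (∀ a < m * d, s'.rmem a = G a) ∧
    (∀ i : Fin n, (i : ℕ) < k → IsRecord G d m (pointInput (x i)) (recAddr d m i) s'.rmem) ∧
    ∀ i : Fin n, s'.rmem (recAddr d m i) = 0 ∧ s'.rmem (recAddr d m i + 1) = 0) rfl ?_ ?_ ?_ le_rfl ?_
  · refine ⟨e12, by simp [e20], e21, fun a ha => ?_, by simp, fun i => ?_⟩
    · rw [em, hmem]
      simpa using writeBlock_apply (mem := fun _ => 0) (o := 0) (f := G) ha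
    · have := le_recAddr d m i
      rw [em, hmem, writeBlock_of_notMem (by omega), writeBlock_of_notMem (by omega)]
      exact ⟨rfl, rfl⟩
  · rintro k hk s2 hf ⟨f12, f20, f21, fmat, frec, fzero⟩
    have fP := eP.of_frame hf (by norm_num)
    have hkn := recAddr_add_le (d := d) (m := m) hk
    have hk0 := le_recAddr d m k
    have hin : 2 + k * d + d ≤ S := by
      refine le_trans ?_ hS
      unfold recAddr
      nlinarith
    refine ⟨by simpa only [Test.Holds, f12, fP.num] using hk, ?_⟩
    refine Wp.mono (Wp.seq (wp_record fP.dim fP.rows fP.one f20 f21 hin (by omega) (by omega) fmat)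
      (T' := 2) ?_) le_rfl fun _ h => h
    rintro s3 ⟨hf3, g20, g21, grec, gmem⟩
    have g12 : s3.ireg 12 = k := by rw [hf3.ireg 12 (by norm_num), f12]
    have gP := fP.of_frame hf3 (by norm_num)
    have hkS : k + 1 ≤ S := by
      refine le_trans ?_ hS
      unfold recAddr
      nlinarith
    refine (Wp.block (Q := fun s' => s'.ireg 12 = k + 1 ∧ s'.ireg 20 = 2 + (k + 1) * d ∧
      s'.ireg 21 = recAddr d m (k + 1) ∧ s'.rmem = s3.rmem) ?_).mono le_rfl ?_
    · simp [Straight, Instr.Legal, Instr.effect, State.setI, g12, g20, g21, gP.one, recAddr_succ, hkS,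
        Nat.succ_mul]
      omega
    rintro s4 ⟨k12, k20, k21, km⟩
    refine ⟨k12, k20, k21, fun a ha => ?_, fun i hi => ?_, fun i => ?_⟩
    · rw [km, gmem a (by omega), fmat a ha]
    · rw [km]
      rcases Nat.lt_succ_iff_lt_or_eq.1 hi with hi | hi
      · refine (frec i hi).congr fun a _ ha => gmem a ?_
        have := recAddr_add_le (d := d) (m := m) hi
        omega
      · rw [← hi] at grec
        refine isRecord_congr_vec grec fun c hc => ?_
        rw [hf.input, hf1.input, hinput, initInput_eq_pointInput ε δ x i hc]
    · rw [km]
      by_cases hik : (i : ℕ) = k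
      · have hadd : recAddr d m i = recAddr d m k := by rw [hik]
        rw [gmem _ (by omega), gmem _ (by omega)]
        exact fzero i
      · rw [gmem _ (by
            have := recAddr_add_lt_of_ne (d := d) (m := m) (a := 0) hik (by omega)
            omega),
          gmem _ (by
            have := recAddr_add_lt_of_ne (d := d) (m := m) (a := 1) hik (by omega)
            omega)]
        exact fzero i
  · rintro s2 hf ⟨f12, -⟩
    simp [Test.Holds, f12, (eP.of_frame hf (by norm_num)).num]
  · rintro s2 hf ⟨-, -, -, fmat, frec, fzero⟩
    refine ⟨eP.of_frame hf (by norm_num), ?_, fmat, fun i => frec i i.2, fun i => (fzero i).1,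
      fun i => (fzero i).2⟩
    rw [hf.rreg 1 (by norm_num), hf1.rreg 1 (by norm_num), htot, Finset.sum_const_zero]

/-- Initializes the data structure. -/
def initProg : Prog := .seq rowCountProg (.seq matrixProg recordsProg)

/-- The number of steps of the initialization. -/
noncomputable def initTime (n d : ℕ) (ε δ : ℝ) : ℕ :=
  39 + 4 * logCount n δ + 8 * rowCount n ε δ + 8 * (rowCount n ε δ * d) +
    n * (rowCount n ε δ * (8 * d + 9) + d * 6 + 14)

theorem wp_init (x : Fin n → EuclideanSpace ℝ (Fin d)) (hn : 1 ≤ n) (hε : 0 < ε) (hδ : 0 < δ) :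
    Wp (cellCount n d ε δ) ω initProg (initTime n d ε δ)
      (Ready d (rowCount n ε δ) (sign ω) (fun i => pointInput (x i)) (fun _ => 0) fun _ => 0)
      (initState ε δ x) := by
  have hn0 := le_recAddr d (rowCount n ε δ) n
  refine Wp.mono (Wp.seq (wp_rowCount hn hε.ne' hδ rfl rfl rfl (by unfold cellCount; omega)
    (by unfold cellCount; omega)) (T' := 8 * (rowCount n ε δ * d) + 4 * rowCount n ε δ + 12 +
      (n * (rowCount n ε δ * (8 * d + 9) + d * 6 + 14) + 5)) ?_) (by unfold initTime; omega)
    fun _ h => h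
  rintro s1 ⟨hf1, e2, e6, e12, er, em, ef⟩
  refine Wp.seq (wp_matrix (by rw [hf1.ireg 1 (by norm_num)]; rfl) e2 e6 e12 er ef
    (by unfold cellCount; omega)) ?_
  rintro s2 ⟨hf2, fP, fm⟩
  refine wp_records (ε := ε) (δ := δ) x fP ?_ ?_ (by rw [fm, em]; rfl) (by unfold cellCount; omega)
    (by unfold cellCount; omega)
  · rw [hf2.rreg 1 (by norm_num), hf1.rreg 1 (by norm_num)]
    rfl
  · rw [hf2.input, hf1.input]
    rfl

end OnlineMatching

/-! ### Random signs preserve Euclidean norms -/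

namespace OnlineMatching

open RealRAM

/-- The sign that is encoded by a bit. -/
def bitSign (b : Bool) : ℝ := if b then 1 else -1

/-- The expectation of `exp (l * (z + X) ^ 2)` over a random sign of `z`. -/
theorem exp_sq_add_exp_sq_le (l z X : ℝ) :
    Real.exp (l * (z + X) ^ 2) + Real.exp (l * (-z + X) ^ 2) ≤
      2 * Real.exp (l * z ^ 2) * Real.exp ((l + 2 * l ^ 2 * z ^ 2) * X ^ 2) := by
  have h1 : Real.exp (l * (z + X) ^ 2) + Real.exp (l * (-z + X) ^ 2) =
      2 * Real.exp (l * z ^ 2 + l * X ^ 2) * Real.cosh (2 * l * z * X) := by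
    rw [Real.cosh_eq, show l * (z + X) ^ 2 = (l * z ^ 2 + l * X ^ 2) + 2 * l * z * X by ring,
      show l * (-z + X) ^ 2 = (l * z ^ 2 + l * X ^ 2) + -(2 * l * z * X) by ring,
      Real.exp_add (l * z ^ 2 + l * X ^ 2), Real.exp_add (l * z ^ 2 + l * X ^ 2)]
    ring
  rw [h1]
  refine (mul_le_mul_of_nonneg_left (Real.cosh_le_exp_half_sq _) (by positivity)).trans_eq ?_
  rw [mul_assoc 2 (Real.exp _), mul_assoc 2 (Real.exp _), ← Real.exp_add, ← Real.exp_add]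
  congr 2
  ring

/-- The moment generating function of the square of a Rademacher sum, by induction on the number of
summands: averaging over one sign turns the parameter `l` into `l + 2 * l ^ 2 * z ^ 2`. The parameter
may be negative, so that the bound serves for both tails. -/
theorem sum_exp_mul_sq_le {d : ℕ} (z : Fin d → ℝ) (l : ℝ) (h : |l| * ∑ c, z c ^ 2 ≤ 1 / 4) :
    ∑ a : Fin d → Bool, Real.exp (l * (∑ c, bitSign (a c) * z c) ^ 2) ≤
      2 ^ d * Real.exp (l * ∑ c, z c ^ 2 + 4 * l ^ 2 * (∑ c, z c ^ 2) ^ 2) := by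
  induction d generalizing l with
  | zero => simp
  | succ d ih =>
    set u := z 0 ^ 2 with hu
    set t := ∑ c : Fin d, z c.succ ^ 2 with ht
    have hu0 : 0 ≤ u := sq_nonneg _
    have ht0 : 0 ≤ t := Finset.sum_nonneg fun _ _ => sq_nonneg _
    rw [Fin.sum_univ_succ, ← hu, ← ht] at h ⊢
    have hl := abs_nonneg l
    have hlu : |l| * u ≤ 1 / 4 := by nlinarith
    have hlt : |l| * t ≤ 1 / 4 := by nlinarith
    obtain ⟨hl1, hl2⟩ := abs_le.1 (le_refl |l|)
    have key : ∑ a : Fin (d + 1) → Bool, Real.exp (l * (∑ c, bitSign (a c) * z c) ^ 2) ≤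
        2 * Real.exp (l * u) * ∑ a : Fin d → Bool,
          Real.exp ((l + 2 * l ^ 2 * u) * (∑ c, bitSign (a c) * z c.succ) ^ 2) := by
      rw [← (Fin.consEquiv fun _ : Fin (d + 1) => Bool).sum_comp, Fintype.sum_prod_type_right,
        Finset.mul_sum]
      refine Finset.sum_le_sum fun a _ => ?_
      simpa [Fin.consEquiv, Fin.sum_univ_succ, bitSign] using
        exp_sq_add_exp_sq_le l (z 0) (∑ c, bitSign (a c) * z c.succ)
    have hsq : l ^ 2 = |l| ^ 2 := (sq_abs l).symm
    have habs : |l + 2 * l ^ 2 * u| * t ≤ 1 / 4 := by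
      rcases le_total 0 l with h0 | h0
      · rw [abs_of_nonneg h0] at *
        rw [abs_of_nonneg (by positivity)]
        nlinarith [mul_nonneg (mul_nonneg h0 ht0) hu0, mul_nonneg h0 hu0, mul_nonneg h0 ht0]
      · rw [abs_of_nonpos h0] at *
        have : l + 2 * l ^ 2 * u ≤ 0 := by nlinarith
        rw [abs_of_nonpos this]
        nlinarith [mul_nonneg (mul_nonneg (sq_nonneg l) hu0) ht0]
    refine key.trans ?_
    refine (mul_le_mul_of_nonneg_left (ih (fun c => z c.succ) (l + 2 * l ^ 2 * u) habs)
      (by positivity)).trans ?_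
    rw [← ht]
    have hexp : l * u + ((l + 2 * l ^ 2 * u) * t + 4 * (l + 2 * l ^ 2 * u) ^ 2 * t ^ 2) ≤
        l * (u + t) + 4 * l ^ 2 * (u + t) ^ 2 := by
      have e1 : l * t ≤ 1 / 4 := (mul_le_mul_of_nonneg_right hl2 ht0).trans hlt
      have e2 : (l * t) ^ 2 ≤ 1 / 16 := by
        have : |l * t| ≤ 1 / 4 := by rwa [abs_mul, abs_of_nonneg ht0]
        nlinarith [sq_abs (l * t), abs_nonneg (l * t)]
      have e3 : l ^ 2 * u * t * (l * t) ≤ l ^ 2 * u * t * (1 / 4) :=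
        mul_le_mul_of_nonneg_left e1 (by positivity)
      have e4 : l ^ 2 * u ^ 2 * (l * t) ^ 2 ≤ l ^ 2 * u ^ 2 * (1 / 16) :=
        mul_le_mul_of_nonneg_left e2 (by positivity)
      have e5 : 0 ≤ l ^ 2 * u * t := by positivity
      have e6 : 0 ≤ l ^ 2 * u ^ 2 := by positivity
      nlinarith
    calc 2 * Real.exp (l * u) * (2 ^ d * Real.exp ((l + 2 * l ^ 2 * u) * t +
          4 * (l + 2 * l ^ 2 * u) ^ 2 * t ^ 2))
        = 2 ^ (d + 1) * Real.exp (l * u + ((l + 2 * l ^ 2 * u) * t +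
          4 * (l + 2 * l ^ 2 * u) ^ 2 * t ^ 2)) := by
          rw [Real.exp_add (l * u)]
          ring
      _ ≤ _ := by gcongr

/-- The squared norm of the product of the sign matrix `A` with the vector `z`. -/
noncomputable def signNormSq {m d : ℕ} (A : Fin m → Fin d → Bool) (z : Fin d → ℝ) : ℝ :=
  ∑ r, (∑ c, bitSign (A r c) * z c) ^ 2

theorem sum_exp_mul_signNormSq_le {m d : ℕ} (z : Fin d → ℝ) (l : ℝ)
    (h : |l| * ∑ c, z c ^ 2 ≤ 1 / 4) :
    ∑ A : Fin m → Fin d → Bool, Real.exp (l * signNormSq A z) ≤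
      (2 ^ d * Real.exp (l * ∑ c, z c ^ 2 + 4 * l ^ 2 * (∑ c, z c ^ 2) ^ 2)) ^ m := by
  simp only [signNormSq, Finset.mul_sum, Real.exp_sum]
  rw [← Fintype.sum_pow (fun a : Fin d → Bool => Real.exp (l * (∑ c, bitSign (a c) * z c) ^ 2))]
  exact pow_le_pow_left₀ (Finset.sum_nonneg fun _ _ => (Real.exp_pos _).le)
    (by simpa only [Finset.mul_sum] using sum_exp_mul_sq_le z l h) m

open Classical in
/-- One tail; `σ = 1` gives the upper and `σ = -1` the lower one. -/
theorem card_signNormSq_tail_le {m d : ℕ} {ε σ : ℝ} (hε : 0 ≤ ε) (hε1 : ε ≤ 1) (hσ : |σ| = 1)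
    (z : Fin d → ℝ) :
    ((Finset.univ.filter fun A : Fin m → Fin d → Bool =>
        ε * (m * ∑ c, z c ^ 2) < σ * (signNormSq A z - m * ∑ c, z c ^ 2)).card : ℝ) ≤
      2 ^ (m * d) * Real.exp (-(m * ε ^ 2 / 16)) := by
  set s := ∑ c, z c ^ 2 with hs
  have hs0 : 0 ≤ s := Finset.sum_nonneg fun _ _ => sq_nonneg _
  have hσ2 : σ ^ 2 = 1 := by rw [← sq_abs, hσ, one_pow]
  rcases hs0.eq_or_lt with hs1 | hs1
  · -- The vector is zero, and so is its image.
    have hz : ∀ c, z c = 0 := fun c => by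
      have := (Finset.sum_eq_zero_iff_of_nonneg fun c _ => sq_nonneg (z c)).1 hs1.symm c
        (Finset.mem_univ c)
      exact pow_eq_zero_iff (two_ne_zero) |>.1 this
    rw [Finset.filter_false_of_mem]
    · simp only [Finset.card_empty, Nat.cast_zero]
      positivity
    · intro A _
      simp [signNormSq, hz, ← hs1]
  set l := σ * ε / (8 * s) with hl
  have hls : l * s = σ * ε / 8 := by
    rw [hl]
    field_simp
  have habs : |l| * s ≤ 1 / 4 := by
    rw [← abs_of_pos hs1, ← abs_mul, hls, abs_div, abs_mul, hσ, abs_of_nonneg hε]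
    norm_num
    linarith
  have hmgf := sum_exp_mul_signNormSq_le (m := m) z l habs
  rw [← hs] at hmgf
  set B := Finset.univ.filter fun A : Fin m → Fin d → Bool =>
    ε * (m * s) < σ * (signNormSq A z - m * s) with hB
  have hmarkov : (B.card : ℝ) * Real.exp (l * (m * s) + m * ε ^ 2 / 8) ≤
      ∑ A : Fin m → Fin d → Bool, Real.exp (l * signNormSq A z) := by
    rw [← nsmul_eq_mul]
    refine (Finset.card_nsmul_le_sum B _ _ fun A hA => ?_).trans
      (Finset.sum_le_sum_of_subset_of_nonneg (Finset.subset_univ B)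
        fun _ _ _ => (Real.exp_pos _).le)
    rw [hB, Finset.mem_filter] at hA
    rw [Real.exp_le_exp]
    have h1 : l * signNormSq A z - l * (m * s) =
        ε / (8 * s) * (σ * (signNormSq A z - m * s)) := by
      rw [hl]
      ring
    have h2 : ε / (8 * s) * (ε * (m * s)) = m * ε ^ 2 / 8 := by
      field_simp
    have h3 := mul_le_mul_of_nonneg_left hA.2.le (show 0 ≤ ε / (8 * s) by positivity)
    linarith
  have hpow : (2 ^ d * Real.exp (l * s + 4 * l ^ 2 * s ^ 2)) ^ m =
      2 ^ (m * d) * Real.exp (-(m * ε ^ 2 / 16)) *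
        Real.exp (l * (m * s) + m * ε ^ 2 / 8) := by
    rw [mul_pow, ← pow_mul, mul_comm d m, ← Real.exp_nat_mul, mul_assoc (2 ^ (m * d)) (Real.exp _),
      ← Real.exp_add]
    congr 2
    have : 4 * l ^ 2 * s ^ 2 = ε ^ 2 / 16 := by
      rw [show 4 * l ^ 2 * s ^ 2 = 4 * (l * s) ^ 2 by ring, hls, div_pow, mul_pow, hσ2]
      ring
    rw [this]
    ring
  rw [hpow] at hmgf
  exact le_of_mul_le_mul_right (hmarkov.trans hmgf) (Real.exp_pos _)

open Classical in
theorem card_signNormSq_far_le {m d : ℕ} {ε : ℝ} (hε : 0 ≤ ε) (hε1 : ε ≤ 1) (z : Fin d → ℝ) :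
    ((Finset.univ.filter fun A : Fin m → Fin d → Bool =>
        ¬ |signNormSq A z - m * ∑ c, z c ^ 2| ≤ ε * (m * ∑ c, z c ^ 2)).card : ℝ) ≤
      2 ^ (m * d) * (2 * Real.exp (-(m * ε ^ 2 / 16))) := by
  have h1 := card_signNormSq_tail_le (m := m) hε hε1 (σ := 1) (by simp) z
  have h2 := card_signNormSq_tail_le (m := m) hε hε1 (σ := -1) (by simp) z
  have h3 := Finset.card_le_card (s := Finset.univ.filter fun A : Fin m → Fin d → Bool =>
    ¬ |signNormSq A z - m * ∑ c, z c ^ 2| ≤ ε * (m * ∑ c, z c ^ 2))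
    (t := (Finset.univ.filter fun A : Fin m → Fin d → Bool =>
        ε * (m * ∑ c, z c ^ 2) < 1 * (signNormSq A z - m * ∑ c, z c ^ 2)) ∪
      Finset.univ.filter fun A : Fin m → Fin d → Bool =>
        ε * (m * ∑ c, z c ^ 2) < -1 * (signNormSq A z - m * ∑ c, z c ^ 2)) (fun A hA => by
      simp only [Finset.mem_filter, Finset.mem_univ, true_and, not_le, Finset.mem_union] at hA ⊢
      rcases lt_abs.1 hA with h | h
      · exact .inl (by linarith)
      · exact .inr (by linarith))
  have h4 : ((Finset.univ.filter fun A : Fin m → Fin d → Bool =>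
        ¬ |signNormSq A z - m * ∑ c, z c ^ 2| ≤ ε * (m * ∑ c, z c ^ 2)).card : ℝ) ≤ _ :=
    Nat.cast_le.2 (h3.trans (Finset.card_union_le _ _))
  rw [Nat.cast_add] at h4
  linarith

/-- The sign matrix that the coins `ω` determine, row by row. -/
def signMatrix (m d : ℕ) (ω : Coins) : Fin m → Fin d → Bool := fun r c => ω (r * d + c)

/-- Different entries of the matrix come from different coins. -/
theorem coinMeasure_signMatrix_eq_le {m d : ℕ} (A : Fin m → Fin d → Bool) :
    coinMeasure {ω | signMatrix m d ω = A} ≤ (2 ^ (m * d))⁻¹ := by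
  set e : Fin m × Fin d → ℕ := fun p => p.1 * d + p.2
  have he : Function.Injective e := by
    intro p q hpq
    refine finProdFinEquiv.injective (Fin.ext ?_)
    simp only [finProdFinEquiv_apply_val]
    simp only [e] at hpq
    linarith
  have hset : {ω | signMatrix m d ω = A} ⊆ Set.pi (Finset.univ.image e : Finset ℕ)
      fun k => {b | ∀ p, e p = k → b = A p.1 p.2} := by
    rintro ω rfl k - p rfl
    rfl
  refine (MeasureTheory.measure_mono hset).trans ?_
  rw [coinMeasure, MeasureTheory.Measure.infinitePi_pi _ fun _ _ => .of_discrete,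
    Finset.prod_image he.injOn]
  have hone : ∀ p, {b | ∀ q, e q = e p → b = A q.1 q.2} = {A p.1 p.2} := by
    intro p
    ext b
    refine ⟨fun h => h p rfl, fun h q hq => ?_⟩
    rw [he hq]
    exact h
  simp only [hone]
  rw [Finset.prod_congr rfl fun p _ =>
    PMF.toMeasure_uniformOfFintype_apply ({A p.1 p.2} : Set Bool) (.singleton _)]
  simp [ENNReal.inv_pow]

open Classical in
theorem coinMeasure_signMatrix_mem_le {m d : ℕ} (B : Finset (Fin m → Fin d → Bool)) {b : ℝ}
    (hb : (B.card : ℝ) ≤ 2 ^ (m * d) * b) :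
    coinMeasure {ω | signMatrix m d ω ∈ B} ≤ ENNReal.ofReal b := by
  have h1 : {ω | signMatrix m d ω ∈ B} = ⋃ A ∈ B, {ω | signMatrix m d ω = A} := by
    ext ω
    simp
  have h2 : (B.card : ENNReal) ≤ 2 ^ (m * d) * ENNReal.ofReal b := by
    rw [← ENNReal.ofReal_natCast]
    refine (ENNReal.ofReal_le_ofReal hb).trans_eq ?_
    rw [ENNReal.ofReal_mul (by positivity), ENNReal.ofReal_pow (by norm_num), ENNReal.ofReal_ofNat]
  rw [h1]
  refine (MeasureTheory.measure_biUnion_finset_le B _).trans ?_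
  refine (Finset.sum_le_sum fun A _ => coinMeasure_signMatrix_eq_le A).trans ?_
  rw [Finset.sum_const, nsmul_eq_mul, ← div_eq_mul_inv]
  exact ENNReal.div_le_of_le_mul (h2.trans_eq (mul_comm _ _))

end OnlineMatching

/-! ### Greedy matchings -/

namespace OnlineMatching

/-- The largest weight of an edge at `i`, for the edges `l` and the weights `φ`. -/
noncomputable def load {n : ℕ} {α : Type*} (φ : Fin n → α → ℝ≥0) (l : List (α × Fin n))
    (i : Fin n) : ℝ≥0 :=
  l.foldl (fun a e => if e.2 = i then max a (φ i e.1) else a) 0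

/-- The matchings that arise when every online point goes to an offline point with the largest gain,
where losses count as zero. -/
inductive IsGreedy {n : ℕ} {α : Type*} (φ : Fin n → α → ℝ≥0) : List (α × Fin n) → Prop
  | nil : IsGreedy φ []
  | concat {l : List (α × Fin n)} {y : α} {b : Fin n} (h : IsGreedy φ l)
      (hb : ∀ i, (φ i y : ℝ) - load φ l i ≤ max 0 ((φ b y : ℝ) - load φ l b)) :
      IsGreedy φ (l ++ [(y, b)])

variable {n : ℕ} {α : Type*} {φ ψ : Fin n → α → ℝ≥0}

theorem load_concat (l : List (α × Fin n)) (y : α) (b : Fin n) :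
    load φ (l ++ [(y, b)]) = Function.update (load φ l) b (max (load φ l b) (φ b y)) := by
  funext i
  by_cases h : b = i
  · subst h
    simp [load]
  · simp [load, h, Function.update_of_ne (Ne.symm h)]

theorem load_le_iff {l : List (α × Fin n)} {i : Fin n} {a : ℝ≥0} :
    load φ l i ≤ a ↔ ∀ e ∈ l, e.2 = i → φ i e.1 ≤ a := by
  induction l using List.reverseRecOn with
  | nil => simp [load]
  | append_singleton l e ih =>
    rw [← Prod.mk.eta (p := e), load_concat]
    by_cases h : e.2 = i
    · subst h
      simp [ih, or_imp, forall_and]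
    · simp [Function.update_of_ne (Ne.symm h), ih, or_imp, forall_and, h]

theorem load_le_mul {c : ℝ} (hc : 0 ≤ c) {l : List (α × Fin n)}
    (h : ∀ e ∈ l, ∀ i, (φ i e.1 : ℝ) ≤ c * ψ i e.1) (i : Fin n) :
    (load φ l i : ℝ) ≤ c * load ψ l i := by
  lift c to ℝ≥0 using hc
  norm_cast at h ⊢
  refine load_le_iff.2 fun e he hi => (h e he i).trans ?_
  gcongr
  exact load_le_iff.1 le_rfl e he hi

/-- The potential argument: a greedy step raises the value of the greedy matching by its gain, and the
sum of the maxima of the loads of the two matchings by at most twice that gain. -/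
theorem IsGreedy.sum_max_load_le {l : List (α × Fin n)} (h : IsGreedy φ l) :
    ∀ l' : List (α × Fin n), l'.map Prod.fst = l.map Prod.fst →
      ∑ i, max (load φ l i : ℝ) (load φ l' i) ≤ 2 * ∑ i, (load φ l i : ℝ) := by
  induction h with
  | nil =>
    intro l' hl'
    simp only [List.map_nil, List.map_eq_nil_iff] at hl'
    subst hl'
    simp [load]
  | @concat l y b h hb ih =>
    intro l' hl'
    rw [List.map_append, List.map_eq_append_iff] at hl'
    obtain ⟨l₁, l₂, rfl, h1, h2⟩ := hl'
    obtain ⟨⟨y', c⟩, rfl⟩ : ∃ e, l₂ = [e] := by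
      rw [← List.length_eq_one_iff, ← List.length_map, h2]
      rfl
    obtain rfl : y' = y := by simpa using h2
    set g := max 0 ((φ b y' : ℝ) - load φ l b) with hg
    have hstep : ∀ i, (load φ (l ++ [(y', b)]) i : ℝ) = load φ l i + if i = b then g else 0 := by
      intro i
      rw [load_concat]
      by_cases hi : i = b
      · subst hi
        simp [hg, ← max_add_add_left]
      · simp [hi]
    have hmax : ∀ i, max (load φ (l ++ [(y', b)]) i : ℝ) (load φ (l₁ ++ [(y', c)]) i) ≤
        max (load φ l i : ℝ) (load φ l₁ i) + (if i = b then g else 0) + if i = c then g else 0 := by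
      intro i
      have hg0 : 0 ≤ g := le_max_left _ _
      have h0 : ∀ j, 0 ≤ if i = j then g else 0 := fun j => by split_ifs <;> simp [hg0]
      have hleft := le_max_left (load φ l i : ℝ) (load φ l₁ i)
      have hright := le_max_right (load φ l i : ℝ) (load φ l₁ i)
      refine max_le ?_ ?_
      · rw [hstep i]
        linarith [h0 c]
      · rw [load_concat]
        by_cases hi : i = c
        · subst hi
          have := hb i
          simp only [Function.update_self, if_true, NNReal.coe_max]
          exact max_le (by linarith [h0 b]) (by linarith [h0 b])
        · rw [Function.update_of_ne hi]
          linarith [h0 b, h0 c]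
    calc _ ≤ ∑ i, (max (load φ l i : ℝ) (load φ l₁ i) + (if i = b then g else 0) +
          if i = c then g else 0) := Finset.sum_le_sum fun i _ => hmax i
      _ = ∑ i, max (load φ l i : ℝ) (load φ l₁ i) + 2 * g := by
          simp [Finset.sum_add_distrib]
          ring
      _ ≤ 2 * ∑ i, (load φ l i : ℝ) + 2 * g := by linarith [ih l₁ h1]
      _ = _ := by
          simp only [hstep, Finset.sum_add_distrib]
          simp
          ring

/-- A greedy matching is worth at least half of every other matching. -/
theorem IsGreedy.sum_load_le {l l' : List (α × Fin n)} (h : IsGreedy φ l)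
    (hl : l'.map Prod.fst = l.map Prod.fst) :
    ∑ i, (load φ l' i : ℝ) ≤ 2 * ∑ i, (load φ l i : ℝ) :=
  (Finset.sum_le_sum fun _ _ => le_max_right _ _).trans (h.sum_max_load_le l' hl)

/-- The Euclidean distance as a weight. -/
noncomputable def distWeight {d : ℕ} (x : Fin n → EuclideanSpace ℝ (Fin d)) (i : Fin n)
    (y : EuclideanSpace ℝ (Fin d)) : ℝ≥0 := nndist (x i) y

variable {d : ℕ} {x : Fin n → EuclideanSpace ℝ (Fin d)}

theorem matchingValue_eq {m : ℕ} (y : Fin m → EuclideanSpace ℝ (Fin d)) (σ : Fin m → Fin n) :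
    matchingValue x y σ =
      ∑ i, (load (distWeight x) (List.ofFn fun j => (y j, σ j)) i : ℝ) := by
  unfold matchingValue
  refine Finset.sum_congr rfl fun i _ => ?_
  congr 1
  refine eq_of_forall_ge_iff fun a => ?_
  simp [load_le_iff, List.mem_ofFn, distWeight]

theorem algValue_eq (es : List (Event n d)) :
    algValue x es = ∑ i, (load (distWeight x) (edges es) i : ℝ) := by
  rw [algValue, matchingValue_eq]
  simp only [Prod.mk.eta]
  rw [List.ofFn_get]

theorem matchingValue_nonneg {m : ℕ} (y : Fin m → EuclideanSpace ℝ (Fin d)) (σ : Fin m → Fin n) :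
    0 ≤ matchingValue x y σ :=
  Finset.sum_nonneg fun _ _ => NNReal.coe_nonneg _

/-- A matching that is greedy for weights that approximate the distances, up to a common factor `a`,
is almost a greedy matching. -/
theorem IsGreedy.competitive [NeZero n] {φ : Fin n → EuclideanSpace ℝ (Fin d) → ℝ≥0}
    {es : List (Event n d)} (h : IsGreedy φ (edges es)) {ε a : ℝ} (hε : 0 < ε) (hε1 : ε < 1)
    (ha : 0 < a)
    (hlo : ∀ e ∈ edges es, ∀ i, (1 - ε) * (a * dist (x i) e.1) ≤ φ i e.1)
    (hhi : ∀ e ∈ edges es, ∀ i, (φ i e.1 : ℝ) ≤ (1 + ε) * (a * dist (x i) e.1)) :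
    1 / 2 * (1 - 2 * ε) * optOf x es ≤ algValue x es := by
  have hlo0 : 0 < (1 - ε) * a := mul_pos (by linarith) ha
  have hhi0 : 0 < (1 + ε) * a := mul_pos (by linarith) ha
  have halg : ∑ i, (load φ (edges es) i : ℝ) ≤ (1 + ε) * a * algValue x es := by
    rw [algValue_eq, Finset.mul_sum]
    refine Finset.sum_le_sum fun i _ => ?_
    exact load_le_mul hhi0.le
      (fun e he i => (hhi e he i).trans_eq (mul_assoc _ _ _).symm) i
  have hopt : optOf x es ≤ 2 * (1 + ε) / (1 - ε) * algValue x es := by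
    refine ciSup_le fun σ => ?_
    rw [matchingValue_eq]
    set l' := List.ofFn fun j => (((edges es).get j).1, σ j) with hl'
    have hfst : l'.map Prod.fst = (edges es).map Prod.fst := by
      rw [hl', List.map_ofFn]
      conv_rhs => rw [← List.ofFn_get (edges es), List.map_ofFn]
      rfl
    have hmem : ∀ e ∈ l', ∃ e' ∈ edges es, e'.1 = e.1 := by
      intro e he
      have : e.1 ∈ (edges es).map Prod.fst := hfst ▸ List.mem_map_of_mem he
      simpa using List.mem_map.1 this
    have hφ : (1 - ε) * a * ∑ i, (load (distWeight x) l' i : ℝ) ≤ ∑ i, (load φ l' i : ℝ) := by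
      rw [Finset.mul_sum]
      refine Finset.sum_le_sum fun i _ => ?_
      rw [← le_inv_mul_iff₀ hlo0]
      refine load_le_mul (inv_nonneg.2 hlo0.le) (fun e he i => ?_) i
      obtain ⟨e', he', hee⟩ := hmem e he
      rw [← hee, le_inv_mul_iff₀ hlo0, mul_assoc]
      exact hlo e' he' i
    have h2 := h.sum_load_le hfst
    rw [div_mul_eq_mul_div, le_div_iff₀ (by linarith)]
    refine le_of_mul_le_mul_left ?_ ha
    nlinarith
  have halg0 : 0 ≤ algValue x es := matchingValue_nonneg _ _
  have hopt0 : 0 ≤ optOf x es := Real.iSup_nonneg fun σ => matchingValue_nonneg _ _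
  rw [div_mul_eq_mul_div, le_div_iff₀ (by linarith)] at hopt
  refine le_of_mul_le_mul_left ?_ (show 0 < 1 + ε by linarith)
  have : (1 + ε) * (1 - 2 * ε) * optOf x es ≤ (1 - ε) * optOf x es :=
    mul_le_mul_of_nonneg_right (by nlinarith) hopt0
  linarith

end OnlineMatching

/-! ### The random matrix and the distances -/

namespace OnlineMatching

open RealRAM

variable {n d m : ℕ} {ω : Coins}

theorem vecDist_pointInput (x y : EuclideanSpace ℝ (Fin d)) :
    vecDist d (pointInput x) (pointInput y) = dist x y := by
  rw [vecDist, EuclideanSpace.dist_eq, Finset.sum_range]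
  simp [pointInput, Real.dist_eq]

/-- The matrix acts linearly, so the distance of two images is the norm of the image of a difference. -/
theorem sketchDist_pointInput (x y : EuclideanSpace ℝ (Fin d)) :
    sketchDist (sign ω) d m (pointInput x) (pointInput y) =
      √(signNormSq (signMatrix m d ω) fun c => x c - y c) := by
  rw [sketchDist, vecDist, signNormSq, Finset.sum_range]
  congr 1
  refine Finset.sum_congr rfl fun r _ => ?_
  rw [← Finset.sum_sub_distrib, Finset.sum_range]
  congr 1
  refine Finset.sum_congr rfl fun c _ => ?_
  simp only [pointInput, c.2, dif_pos, signMatrix, sign, bitSign]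
  exact (mul_sub _ _ _).symm

/-- For the coins `ω`, the sign matrix multiplies the squared distance of `x` and `y` by `m`, up to a
factor `1 ± ε`. -/
def Preserves (m : ℕ) (ε : ℝ) (ω : Coins) (x y : EuclideanSpace ℝ (Fin d)) : Prop :=
  |signNormSq (signMatrix m d ω) (fun c => x c - y c) - m * ∑ c, (x c - y c) ^ 2| ≤
    ε * (m * ∑ c, (x c - y c) ^ 2)

theorem Preserves.le_sketchDist {ε : ℝ} (hε : 0 < ε) (hε1 : ε < 1)
    {x y : EuclideanSpace ℝ (Fin d)} (h : Preserves m ε ω x y) :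
    (1 - ε) * (√m * dist x y) ≤ sketchDist (sign ω) d m (pointInput x) (pointInput y) := by
  have hs : ∑ c, (x c - y c) ^ 2 = dist x y ^ 2 := by
    rw [EuclideanSpace.dist_eq, Real.sq_sqrt (by positivity)]
    simp [Real.dist_eq]
  rw [Preserves, hs, abs_le] at h
  rw [sketchDist_pointInput]
  refine Real.le_sqrt_of_sq_le ?_
  rw [mul_pow, mul_pow, Real.sq_sqrt (Nat.cast_nonneg m)]
  have : 0 ≤ (m : ℝ) * dist x y ^ 2 := by positivity
  have h1 : (1 - ε) ^ 2 * (m * dist x y ^ 2) ≤ (1 - ε) * (m * dist x y ^ 2) :=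
    mul_le_mul_of_nonneg_right (by nlinarith [hε]) this
  linarith

theorem Preserves.sketchDist_le {ε : ℝ} (hε : 0 < ε)
    {x y : EuclideanSpace ℝ (Fin d)} (h : Preserves m ε ω x y) :
    sketchDist (sign ω) d m (pointInput x) (pointInput y) ≤ (1 + ε) * (√m * dist x y) := by
  have hs : ∑ c, (x c - y c) ^ 2 = dist x y ^ 2 := by
    rw [EuclideanSpace.dist_eq, Real.sq_sqrt (by positivity)]
    simp [Real.dist_eq]
  rw [Preserves, hs, abs_le] at h
  rw [sketchDist_pointInput]
  refine (Real.sqrt_le_left (by positivity)).2 ?_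
  rw [mul_pow, mul_pow, Real.sq_sqrt (Nat.cast_nonneg m)]
  have : 0 ≤ (m : ℝ) * dist x y ^ 2 := by positivity
  nlinarith

theorem coinMeasure_not_preserves_le {ε : ℝ} (hε : 0 < ε) (hε1 : ε < 1)
    (x y : EuclideanSpace ℝ (Fin d)) :
    coinMeasure {ω | ¬ Preserves m ε ω x y} ≤
      ENNReal.ofReal (2 * Real.exp (-(m * ε ^ 2 / 16))) := by
  classical
  refine le_of_eq_of_le (congrArg _ ?_) (coinMeasure_signMatrix_mem_le _
    (card_signNormSq_far_le (m := m) hε.le hε1.le fun c => x c - y c))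
  ext ω
  simp [Preserves]

theorem two_le_div {δ : ℝ} (hn : 1 ≤ n) (hδ : 0 < δ) (hδ1 : δ < 1) : 2 ≤ 2 * (n : ℝ) / δ := by
  have : (1 : ℝ) ≤ n := by exact_mod_cast hn
  rw [le_div_iff₀ hδ]
  nlinarith

theorem one_le_logCount {δ : ℝ} (hn : 1 ≤ n) (hδ : 0 < δ) (hδ1 : δ < 1) :
    1 ≤ logCount n δ := by
  rw [Nat.one_le_iff_ne_zero, ← Nat.pos_iff_ne_zero, lt_logCount_iff hn hδ]
  linarith [two_le_div hn hδ hδ1]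

theorem logCount_le_mul_log {δ : ℝ} (hn : 1 ≤ n) (hδ : 0 < δ) (hδ1 : δ < 1) :
    (logCount n δ : ℝ) ≤ 3 * Real.log (2 * n / δ) := by
  have h2 := two_le_div hn hδ hδ1
  have hlog2 := Real.log_two_gt_d9
  have hlog : Real.log 2 ≤ Real.log (2 * n / δ) := Real.log_le_log (by norm_num) h2
  have h := Nat.ceil_lt_add_one (a := Real.logb 2 (2 * n / δ))
    (Real.logb_nonneg (by norm_num) (by linarith))
  have hle : Real.logb 2 (2 * n / δ) + 1 ≤ 3 * Real.log (2 * n / δ) := by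
    rw [Real.logb, div_add_one (by linarith), div_le_iff₀ (by linarith)]
    nlinarith
  exact h.le.trans hle

theorem logCount_mul_le_rowCount {ε δ : ℝ} (hε : 0 < ε) :
    32 * (logCount n δ : ℝ) ≤ rowCount n ε δ * ε ^ 2 := by
  have h := Nat.le_ceil ((logCount n δ : ℝ) * 32 / ε / ε)
  rw [div_div, ← sq, div_le_iff₀ (by positivity)] at h
  rw [rowCount, div_div, ← sq]
  linarith

theorem rowCount_le {ε δ : ℝ} (hn : 1 ≤ n) (hε : 0 < ε) (hε1 : ε < 1) (hδ : 0 < δ) (hδ1 : δ < 1) :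
    (rowCount n ε δ : ℝ) ≤ 100 * ((ε ^ 2)⁻¹ * Real.log (2 * n / δ)) := by
  have hL : (1 : ℝ) ≤ logCount n δ := by exact_mod_cast one_le_logCount hn hδ hδ1
  have hL3 := logCount_le_mul_log hn hδ hδ1
  have h := Nat.ceil_lt_add_one (a := (logCount n δ : ℝ) * 32 / ε / ε) (by positivity)
  have hε2 : 0 < ε ^ 2 := by positivity
  have hε21 : ε ^ 2 ≤ 1 := by nlinarith
  refine h.le.trans ?_
  rw [div_div, ← sq, div_add_one hε2.ne', inv_mul_eq_div, mul_div_assoc', div_le_div_iff_of_pos_right hε2]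
  linarith

/-- The number of rows suffices for a union bound over all pairs of points. -/
theorem sq_mul_exp_rowCount_le {ε δ : ℝ} (hn : 1 ≤ n) (hε : 0 < ε) (hδ : 0 < δ) (hδ1 : δ < 1) :
    (n : ℝ) * n * (2 * Real.exp (-(rowCount n ε δ * ε ^ 2 / 16))) ≤ δ := by
  set L := logCount n δ with hL
  have h1 : Real.exp (-(rowCount n ε δ * ε ^ 2 / 16)) ≤ (((2 : ℝ) ^ L)⁻¹) ^ 2 := by
    have h2 : Real.exp (-1) ≤ 2⁻¹ := by
      rw [Real.exp_neg]
      gcongr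
      linarith [Real.add_one_le_exp 1]
    calc _ ≤ Real.exp (-(2 * L)) := by
          rw [Real.exp_le_exp]
          linarith [logCount_mul_le_rowCount (n := n) (δ := δ) hε]
      _ = (Real.exp (-1) ^ L) ^ 2 := by
          rw [← Real.exp_nat_mul, ← Real.exp_nat_mul]
          congr 1
          push_cast
          ring
      _ ≤ ((2⁻¹ : ℝ) ^ L) ^ 2 := by gcongr
      _ = _ := by rw [inv_pow]
  have hn0 : (0 : ℝ) < n := by exact_mod_cast hn
  have h3 : 2 * (n : ℝ) / δ ≤ 2 ^ L := not_lt.1 ((lt_logCount_iff hn hδ).not.1 (lt_irrefl L))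
  have h4 : ((2 : ℝ) ^ L)⁻¹ ≤ δ / (2 * n) := by
    rw [← inv_div]
    gcongr
  calc _ ≤ (n : ℝ) * n * (2 * (δ / (2 * n)) ^ 2) := by
        gcongr
        exact h1.trans (by gcongr)
    _ = δ * (δ / 2) := by
        field_simp
    _ ≤ δ := by nlinarith

/-- The online points in a sequence of requests. -/
def points : List (Request d) → List (EuclideanSpace ℝ (Fin d))
  | [] => []
  | .update y :: rs => y :: points rs
  | .query :: rs => points rs

theorem length_points (rs : List (Request d)) : (points rs).length = numUpdates rs := by
  induction rs with
  | nil => rfl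
  | cons r rs ih => cases r <;> simp [points, numUpdates, ih]

theorem edges_map_fst (es : List (Event n d)) :
    (edges es).map Prod.fst = points (es.map Event.request) := by
  induction es with
  | nil => rfl
  | cons e es ih => cases e <;> simp [points, edges, Event.request, ih]

theorem edges_append (es es' : List (Event n d)) : edges (es ++ es') = edges es ++ edges es' := by
  induction es with
  | nil => rfl
  | cons e es ih => cases e <;> simp [edges, ih]

/-- With probability at least `1 - δ`, the distances of `n` offline and at most `n` online points are all
preserved. -/
theorem ofReal_le_coinMeasure_preserves {ε δ : ℝ} (hn : 1 ≤ n) (hε : 0 < ε) (hε1 : ε < 1)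
    (hδ : 0 < δ) (hδ1 : δ < 1) (x : Fin n → EuclideanSpace ℝ (Fin d))
    {ys : List (EuclideanSpace ℝ (Fin d))} (hys : ys.length ≤ n) :
    ENNReal.ofReal (1 - δ) ≤
      coinMeasure {ω | ∀ y ∈ ys, ∀ i, Preserves (rowCount n ε δ) ε ω (x i) y} := by
  set good := {ω | ∀ y ∈ ys, ∀ i, Preserves (rowCount n ε δ) ε ω (x i) y} with hgood
  have hbad : coinMeasure goodᶜ ≤ ENNReal.ofReal δ := by
    have hsub : goodᶜ ⊆ ⋃ p : Fin ys.length × Fin n,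
        {ω | ¬ Preserves (rowCount n ε δ) ε ω (x p.2) (ys.get p.1)} := by
      intro ω hω
      simp only [hgood, Set.mem_compl_iff, Set.mem_ofPred_eq, not_forall] at hω
      obtain ⟨y, hy, i, h⟩ := hω
      obtain ⟨j, rfl⟩ := List.mem_iff_get.1 hy
      exact Set.mem_iUnion.2 ⟨(j, i), h⟩
    refine (MeasureTheory.measure_mono hsub).trans
      ((MeasureTheory.measure_iUnion_fintype_le _ _).trans ?_)
    refine (Finset.sum_le_sum fun p _ => coinMeasure_not_preserves_le hε hε1 _ _).trans ?_
    rw [Finset.sum_const, nsmul_eq_mul, ← ENNReal.ofReal_natCast,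
      ← ENNReal.ofReal_mul (Nat.cast_nonneg _)]
    refine ENNReal.ofReal_le_ofReal (le_trans ?_ (sq_mul_exp_rowCount_le hn hε hδ hδ1))
    simp only [Finset.card_univ, Fintype.card_prod, Fintype.card_fin, Nat.cast_mul]
    gcongr
  have huniv : coinMeasure Set.univ = 1 := by
    unfold coinMeasure
    exact MeasureTheory.measure_univ
  rw [ENNReal.ofReal_sub _ hδ.le, ENNReal.ofReal_one, tsub_le_iff_right, ← huniv,
    ← Set.union_compl_self good]
  exact (MeasureTheory.measure_union_le _ _).trans (by gcongr)

/-! ### The data structure -/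

/-- Returns the value of the matching, which is kept up to date in real register `1`. -/
def queryProg : Prog := .prim (.rmove 0 1)

/-- The data structure: greedy matching with respect to the distances after a random projection. -/
def greedyDataStructure : DataStructure := ⟨initProg, updateProg, queryProg⟩

theorem Ready.of_eq {G : ℕ → ℝ} {X : Fin n → ℕ → ℝ} {w v : Fin n → ℝ} {s s' : State}
    (h : Ready d m G X w v s) (hi : s'.ireg = s.ireg) (hr : s'.rreg 1 = s.rreg 1)
    (hm : s'.rmem = s.rmem) : Ready d m G X w v s' := by
  obtain ⟨⟨h1, h2, h3, h4, h5, h6⟩, ht, hs⟩ := h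
  exact ⟨⟨by rw [hi, h1], by rw [hi, h2], by rw [hi, h3], by rw [hi, h4], by rw [hi, h5],
    by rw [hi, h6]⟩, by rw [hr, ht], by rw [hm]; exact hs⟩

/-- The distance of the images of an offline point and an online point, as a weight. -/
noncomputable def sketchWeight (m : ℕ) (ω : Coins) (x : Fin n → EuclideanSpace ℝ (Fin d))
    (i : Fin n) (y : EuclideanSpace ℝ (Fin d)) : ℝ≥0 :=
  ⟨sketchDist (sign ω) d m (pointInput (x i)) (pointInput y), Real.sqrt_nonneg _⟩

/-- The configurations in which the matching `l` has been built. -/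
def Holding (m : ℕ) (ω : Coins) (x : Fin n → EuclideanSpace ℝ (Fin d))
    (l : List (EuclideanSpace ℝ (Fin d) × Fin n)) (s : State) : Prop :=
  Ready d m (sign ω) (fun i => pointInput (x i)) (fun i => (load (distWeight x) l i : ℝ))
    (fun i => (load (sketchWeight m ω x) l i : ℝ)) s

theorem coe_load_concat {α : Type*} (φ : Fin n → α → ℝ≥0) (l : List (α × Fin n)) (y : α)
    (b : Fin n) : (fun i => (load φ (l ++ [(y, b)]) i : ℝ)) =
      Function.update (fun i => (load φ l i : ℝ)) b (max (load φ l b : ℝ) (φ b y)) := by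
  rw [load_concat]
  funext i
  by_cases h : i = b
  · subst h
    simp
  · simp [h]

/-- The number of steps of an update. -/
def updateTime (n d m : ℕ) : ℕ := m * (8 * d + 9) + d * 15 + n * (9 * m + 26) + 50

/-- From a configuration that holds the matching of the events `pre`, every sequence of requests can be
served, with exact answers and greedy choices. -/
theorem exists_session [NeZero n] {S : ℕ} {TU TQ : ℝ} (hS : recAddr d m n ≤ S)
    (hTU : (updateTime n d m : ℝ) ≤ TU) (hTQ : 1 ≤ TQ) (x : Fin n → EuclideanSpace ℝ (Fin d))
    (rs : List (Request d)) :
    ∀ (pre : List (Event n d)) (s : State), IsGreedy (sketchWeight m ω x) (edges pre) →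
      Holding m ω x (edges pre) s →
      ∃ es : List (Event n d), es.map Event.request = rs ∧
        Session greedyDataStructure S TU TQ ω s es ∧
        (∀ q v, q ++ [Event.answered v] <+: es → v = algValue x (pre ++ q)) ∧
        ∀ q, q <+: es → IsGreedy (sketchWeight m ω x) (edges (pre ++ q)) := by
  induction rs with
  | nil =>
    intro pre s hg _
    refine ⟨[], rfl, .nil s, fun q v h => by simp at h, fun q h => ?_⟩
    rw [List.prefix_nil.1 h, List.append_nil]
    exact hg
  | cons r rs ih =>
    intro pre s hg hs
    -- It suffices to serve the first request.
    suffices h : ∃ (e : Event n d) (s' : State), e.request = r ∧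
        IsGreedy (sketchWeight m ω x) (edges (pre ++ [e])) ∧ Holding m ω x (edges (pre ++ [e])) s' ∧
        (∀ es, Session greedyDataStructure S TU TQ ω s' es →
          Session greedyDataStructure S TU TQ ω s (e :: es)) ∧
        ∀ v, e = .answered v → v = algValue x pre by
      obtain ⟨e, s', he, hg', hs', hsess, hans⟩ := h
      obtain ⟨es, h1, h2, h3, h4⟩ := ih (pre ++ [e]) s' hg' hs'
      refine ⟨e :: es, by rw [List.map_cons, he, h1], hsess es h2, fun q v hq => ?_, fun q hq => ?_⟩
      · cases q with
        | nil =>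
          rw [List.nil_append, List.cons_prefix_cons] at hq
          rw [List.append_nil]
          exact hans v hq.1.symm
        | cons e' q =>
          rw [List.cons_append, List.cons_prefix_cons] at hq
          obtain ⟨rfl, hq⟩ := hq
          simpa using h3 q v hq
      · cases q with
        | nil => simpa using hg
        | cons e' q =>
          rw [List.cons_prefix_cons] at hq
          obtain ⟨rfl, hq⟩ := hq
          simpa using h4 q hq
    cases r with
    | update y =>
      have hs0 : Holding m ω x (edges pre) { s with input := pointInput y } :=
        Ready.of_eq hs rfl rfl rfl
      obtain ⟨t, s', hexec, ht, b, hb, hR, hgain⟩ := wp_update (S := S) (ω := ω) hs0 hS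
      refine ⟨.matched y b, s', rfl, ?_, ?_, fun es hes => .update hexec ?_ hb hes, by simp⟩
      · rw [edges_append]
        exact .concat hg hgain
      · rw [edges_append]
        simp only [vecDist_pointInput] at hR
        unfold Holding
        simp only [edges, coe_load_concat]
        exact hR
      · exact le_trans (by exact_mod_cast ht) hTU
    | query =>
      refine ⟨.answered (algValue x pre), { s with input := fun _ => 0 }.setR 0 (s.rreg 1), rfl, ?_,
        ?_, fun es hes => .query (.prim rfl) (by simpa using hTQ) ?_ hes, fun v hv => ?_⟩
      · simpa [edges_append, edges] using hg
      · rw [edges_append, edges, edges, List.append_nil]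
        exact Ready.of_eq hs rfl rfl rfl
      · rw [algValue_eq, ← hs.total]
        rfl
      · cases hv
        rfl

end OnlineMatching

theorem theorem4p2 :
    ∃ (A : OnlineMatching.DataStructure) (C : ℝ) (k : ℕ), 0 < C ∧
      ∀ (n d : ℕ) (ε δ : ℝ), 1 ≤ n → 1 ≤ d → 0 < ε → ε < 1 → 0 < δ → δ < 1 →
        -- space
        ∃ S : ℕ,
          2 * (S : ℝ) ≤ OnlineMatching.softO C k ((ε ^ 2)⁻¹ * n * d * Real.log (2 * n / δ)) ∧
          ∀ (x : Fin n → EuclideanSpace ℝ (Fin d)) (rs : List (OnlineMatching.Request d)),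
            OnlineMatching.numUpdates rs ≤ n →
            ∃ es : RealRAM.Coins → List (OnlineMatching.Event n d),
              (∀ ω : RealRAM.Coins,
                (es ω).map OnlineMatching.Event.request = rs ∧
                -- running times of the three procedures
                OnlineMatching.IsRun A S
                  (OnlineMatching.softO C k ((ε ^ 2)⁻¹ * n * d * Real.log (2 * n / δ)))
                  (OnlineMatching.softO C k ((ε ^ 2)⁻¹ * (n + d) * Real.log (2 * n / δ)))
                  C ω ε δ x (es ω) ∧
                OnlineMatching.AnswersMatchingValue x (es ω)) ∧
              -- competitive ratio
              ENNReal.ofReal (1 - δ) ≤ RealRAM.coinMeasure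
                {ω | OnlineMatching.Competitive ((1 / 2) * (1 - 2 * ε)) x (es ω)} := by
  open OnlineMatching RealRAM in
  refine ⟨greedyDataStructure, 10000, 0, by norm_num, fun n d ε δ hn hd hε hε1 hδ hδ1 => ?_⟩
  have : NeZero n := ⟨by omega⟩
  set m := rowCount n ε δ with hm
  have hLm : logCount n δ ≤ m := by
    have h := logCount_mul_le_rowCount (n := n) (δ := δ) hε
    have : (logCount n δ : ℝ) ≤ rowCount n ε δ := by
      have h1 : rowCount n ε δ * ε ^ 2 ≤ (rowCount n ε δ : ℝ) * 1 := by
        gcongr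
        nlinarith
      linarith [(Nat.cast_nonneg (logCount n δ) : (0 : ℝ) ≤ _)]
    exact_mod_cast this
  have hm1 : 1 ≤ m := (one_le_logCount hn hδ hδ1).trans hLm
  have hmu : (m : ℝ) ≤ 100 * ((ε ^ 2)⁻¹ * Real.log (2 * n / δ)) := rowCount_le hn hε hε1 hδ hδ1
  -- All costs are bounded by multiples of `m * n * d` and `m * (n + d)`.
  have hmd : m * d ≤ m * n * d := Nat.mul_le_mul_right d (Nat.le_mul_of_pos_right m hn)
  have hmn : m * n ≤ m * n * d := Nat.le_mul_of_pos_right _ hd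
  have hnd : n * d ≤ m * n * d := Nat.mul_le_mul_right d (Nat.le_mul_of_pos_left n hm1)
  have hmm : m ≤ m * n := Nat.le_mul_of_pos_right m hn
  have hnn : n ≤ m * n := Nat.le_mul_of_pos_left n hm1
  have hdd : d ≤ m * d := Nat.le_mul_of_pos_left d hm1
  have hcell : cellCount n d ε δ ≤ 41 * (m * n * d) := by
    unfold cellCount recAddr
    rw [← hm]
    linarith
  have hinit : initTime n d ε δ ≤ 96 * (m * n * d) := by
    unfold initTime
    rw [← hm]
    linarith
  have hupdate : updateTime n d m ≤ 82 * (m * (n + d)) := by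
    unfold updateTime
    linarith
  have hmnd : ((m * n * d : ℕ) : ℝ) ≤ 100 * ((ε ^ 2)⁻¹ * n * d * Real.log (2 * n / δ)) := by
    push_cast
    calc (m : ℝ) * n * d ≤ 100 * ((ε ^ 2)⁻¹ * Real.log (2 * n / δ)) * n * d := by gcongr
      _ = _ := by ring
  have hmnd' : ((m * (n + d) : ℕ) : ℝ) ≤
      100 * ((ε ^ 2)⁻¹ * (n + d) * Real.log (2 * n / δ)) := by
    push_cast
    calc (m : ℝ) * (n + d) ≤ 100 * ((ε ^ 2)⁻¹ * Real.log (2 * n / δ)) * (n + d) := by gcongr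
      _ = _ := by ring
  have hcell' : (cellCount n d ε δ : ℝ) ≤ 41 * (m * n * d : ℕ) := by exact_mod_cast hcell
  have hinit' : (initTime n d ε δ : ℝ) ≤ 96 * (m * n * d : ℕ) := by exact_mod_cast hinit
  have hupdate' : (updateTime n d m : ℝ) ≤ 82 * (m * (n + d) : ℕ) := by exact_mod_cast hupdate
  have h0 : (0 : ℝ) ≤ (m * n * d : ℕ) := Nat.cast_nonneg _
  have h0' : (0 : ℝ) ≤ (m * (n + d) : ℕ) := Nat.cast_nonneg _
  refine ⟨cellCount n d ε δ, ?_, fun x rs hrs => ?_⟩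
  · rw [softO, pow_zero, mul_one]
    linarith
  have hrun : ∀ ω : Coins, ∃ es : List (Event n d), es.map Event.request = rs ∧
      IsRun greedyDataStructure (cellCount n d ε δ)
        (softO 10000 0 ((ε ^ 2)⁻¹ * n * d * Real.log (2 * n / δ)))
        (softO 10000 0 ((ε ^ 2)⁻¹ * (n + d) * Real.log (2 * n / δ))) 10000 ω ε δ x es ∧
      AnswersMatchingValue x es ∧ ∀ q, q <+: es → IsGreedy (sketchWeight m ω x) (edges q) := by
    intro ω
    obtain ⟨t, s, hexec, ht, hR⟩ := wp_init (ω := ω) x hn hε hδ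
    obtain ⟨es, h1, h2, h3, h4⟩ := exists_session (m := m) (ω := ω)
      (TU := softO 10000 0 ((ε ^ 2)⁻¹ * (n + d) * Real.log (2 * n / δ))) (TQ := 10000)
      (S := cellCount n d ε δ) (Nat.le_add_right _ _)
      (by rw [softO, pow_zero, mul_one]; linarith) (by norm_num) x rs [] s .nil hR
    refine ⟨es, h1, ⟨t, s, hexec, ?_, h2⟩, h3, h4⟩
    rw [softO, pow_zero, mul_one]
    have : (t : ℝ) ≤ initTime n d ε δ := by exact_mod_cast ht
    linarith
  choose es h1 h2 h3 h4 using hrun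
  refine ⟨es, fun ω => ⟨h1 ω, h2 ω, h3 ω⟩, ?_⟩
  refine (ofReal_le_coinMeasure_preserves hn hε hε1 hδ hδ1 x (ys := points rs)
    (by rwa [length_points])).trans (MeasureTheory.measure_mono fun ω hω pre hpre => ?_)
  have hmem : ∀ e ∈ edges pre, e.1 ∈ points rs := by
    intro e he
    obtain ⟨q, hq⟩ := hpre
    rw [← h1 ω, ← edges_map_fst, ← hq, edges_append]
    exact List.mem_map_of_mem (List.mem_append_left _ he)
  exact (h4 ω pre hpre).competitive hε hε1 (Real.sqrt_pos.2 (by exact_mod_cast hm1))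
    (fun e he i => (hω e.1 (hmem e he) i).le_sketchDist hε hε1)
    (fun e he i => (hω e.1 (hmem e he) i).sketchDist_le hε)
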